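/- **Theorem 1.2.** All matroids have finite ground sets. For a matroid $M$ on $E$ with rank function $\operatorname{rk}$, let $\mathscr L(M)$ be its set of flats; for $F\in\mathscr L(M)$ let $M^F=M|_F$ be the restriction of $M$ to $F$ and $M_F=M/F$ the contraction by $F$. Let $$\chi_M(t)=\sum_{A\subseteq E}(-1)^{|A|}\,t^{\operatorname{rk}(M)-\operatorname{rk}(A)}$$ be the characteristic polynomial of $M$ (it is $0$ if $M$ has a loop). The Kazhdan–Lusztig polynomials $P_M$ and the inverse Kazhdan–Lusztig polynomials $Q_M$ are the unique assignments $M\mapsto P_M,Q_M\in\mathbb Z[t]$ such that 1. if $\operatorname{rk}(M)=0$, then $P_M=Q_M=1$ when $E=\varnothing$, and $P_M=Q_M=0$ when $E\neq\varnothing$; 2. if $\operatorname{rk}(M)>0$, then $\deg P_M<\tfrac12\operatorname{rk}(M)$ and $\deg Q_M<\tfrac12\operatorname{rk}(M)$; 3. for every $M$, $$t^{\operatorname{rk}(M)}P_M(t^{-1})=\sum_{F\in\mathscr L(M)}\chi_{M^F}(t)\,P_{M_F}(t),$$ $$(-t)^{\operatorname{rk}(M)}Q_M(t^{-1})=\sum_{F\in\mathscr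 L(M)}(-1)^{\operatorname{rk}(F)}\,Q_{M^F}(t)\;t^{\operatorname{rk}(M)-\operatorname{rk}(F)}\,\chi_{M_F}(t^{-1}).$$ The $Z$-polynomial is $Z_M(t)=\sum_{F\in\mathscr L(M)}t^{\operatorname{rk}(F)}P_{M_F}(t)$. A hyperplane of a matroid $M$ of rank $k$ is a flat of rank $k-1$; a hyperplane $H$ is *stressed* if every $k$-element subset of $H$ is a circuit of $M$. In that case the bases of $M$ together with the $k$-element subsets of $H$ are the bases of a matroid $\widetilde M$ on $E$, the *relaxation* of $M$ at $H$. For every pair of integers $k,h\ge 1$ there exist polynomials $p_{k,h},q_{k,h},z_{k,h}\in\mathbb Z[t]$ with the following property: for every matroid $M$ of rank $k$ and every stressed hyperplane $H$ of $M$ with $|H|=h$, the relaxation $\widetilde M$ of $M$ at $H$ satisfies $$P_{\widetilde M}(t)=P_M(t)+p_{k,h}(t),\qquad Q_{\widetilde M}(t)=Q_M(t)+q_{k,h}(t),\qquad Z_{\widetilde M}(t)=Z_M(t)+z_{k,h}(t).$$ -/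

import Mathlib

open Polynomial

set_option linter.unusedSectionVars false

namespace Matroid

variable {α : Type*}

/-- The rank `rk(A)` of a set `A` in a (finite) matroid, as a natural number. -/
noncomputable def rk (M : Matroid α) (A : Set α) : ℕ := (M.eRk A).toNat

/-- The rank `rk(M) = rk(E)` of a (finite) matroid, as a natural number. -/
noncomputable def rank (M : Matroid α) : ℕ := M.rk M.E

/-- A hyperplane is a flat of rank `rk(M) - 1`. -/
def IsHyperplane (M : Matroid α) (H : Set α) : Prop :=
  M.IsFlat H ∧ M.rk H + 1 = M.rank

/-- A hyperplane is stressed if all of its subsets of cardinality `rk(M)` are circuits. -/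
def IsStressedHyperplane (M : Matroid α) (H : Set α) : Prop :=
  M.IsHyperplane H ∧ ∀ S ⊆ H, S.ncard = M.rank → M.IsCircuit S

/-- The characteristic polynomial `χ_M(t) = ∑_{A ⊆ E} (-1)^|A| t^(rk(M) - rk(A))` of a finite matroid,
that is, `(-1)^rk(M) T_M(1 - t, 0)` for the Tutte polynomial `T_M`. It is the characteristic
polynomial of the lattice of flats if `M` has no loops, and it is `0` otherwise. -/
noncomputable def charPoly (M : Matroid α) : ℤ[X] :=
  ∑ᶠ (A : Set α) (_ : A ⊆ M.E), (-1) ^ A.ncard * X ^ (M.rank - M.rk A)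

/-- The defining conditions of the Kazhdan--Lusztig polynomials of matroids, for an assignment
`M ↦ P_M` of integer polynomials to the finite matroids with ground set in a given type:
* if `rk(M) = 0`, then `P_M = 1` when `M` is empty, and `P_M = 0` otherwise;
* if `rk(M) > 0`, then `deg P_M < rk(M) / 2`;
* `t^rk(M) P_M(t⁻¹) = ∑_F χ_{M^F}(t) P_{M_F}(t)`, the sum over all flats `F` of `M`.

Here `M^F = M ↾ F` is the localization and `M_F = M ／ F` the contraction. For a polynomial `p` of
degree at most `n`, `p.reflect n` is the polynomial `t^n p(t⁻¹)`, and the degree of `P_M` is at most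
`rk(M)` by the first two conditions. -/
structure IsKLFamily (P : Matroid α → ℤ[X]) : Prop where
  eq_one : ∀ M : Matroid α, M.Finite → M.rank = 0 → M.E = ∅ → P M = 1
  eq_zero : ∀ M : Matroid α, M.Finite → M.rank = 0 → M.E ≠ ∅ → P M = 0
  degree_lt : ∀ M : Matroid α, M.Finite → 0 < M.rank → 2 * (P M).natDegree < M.rank
  reflect_eq : ∀ M : Matroid α, M.Finite →
    (P M).reflect M.rank = ∑ᶠ (F : Set α) (_ : M.IsFlat F), (M ↾ F).charPoly * P (M ／ F)

/-- The defining conditions of the inverse Kazhdan--Lusztig polynomials of matroids: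
* if `rk(M) = 0`, then `Q_M = 1` when `M` is empty, and `Q_M = 0` otherwise;
* if `rk(M) > 0`, then `deg Q_M < rk(M) / 2`;
* `(-t)^rk(M) Q_M(t⁻¹) = ∑_F (-1)^rk(F) Q_{M^F}(t) t^(rk(M) - rk(F)) χ_{M_F}(t⁻¹)`, the sum over
  all flats `F` of `M`.

Note that `χ_{M_F}` has degree at most `rk(M_F) = rk(M) - rk(F)`. -/
structure IsInvKLFamily (Q : Matroid α → ℤ[X]) : Prop where
  eq_one : ∀ M : Matroid α, M.Finite → M.rank = 0 → M.E = ∅ → Q M = 1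
  eq_zero : ∀ M : Matroid α, M.Finite → M.rank = 0 → M.E ≠ ∅ → Q M = 0
  degree_lt : ∀ M : Matroid α, M.Finite → 0 < M.rank → 2 * (Q M).natDegree < M.rank
  reflect_eq : ∀ M : Matroid α, M.Finite →
    (-1) ^ M.rank * (Q M).reflect M.rank = ∑ᶠ (F : Set α) (_ : M.IsFlat F),
      (-1) ^ M.rk F * Q (M ↾ F) * (M ／ F).charPoly.reflect (M.rank - M.rk F)

section basics

variable (M : Matroid α) [M.Finite] {A B F G : Set α}

lemma coe_rk (A : Set α) : (M.rk A : ℕ∞) = M.eRk A :=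
  ENat.natCast_toNat (eRk_ne_top_iff.2 (RankFinite.isRkFinite A))

lemma coe_rank : (M.rank : ℕ∞) = M.eRank := by
  rw [rank, coe_rk, eRk_ground]

lemma rk_mono (h : A ⊆ B) : M.rk A ≤ M.rk B := by
  have := M.eRk_mono h
  rw [← coe_rk, ← coe_rk] at this
  exact_mod_cast this

lemma rk_le_rank (A : Set α) : M.rk A ≤ M.rank := by
  have := M.eRk_le_eRank A
  rw [← coe_rk, ← coe_rank] at this
  exact_mod_cast this

lemma rk_closure (A : Set α) : M.rk (M.closure A) = M.rk A := by
  simp [rk]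

lemma rk_restrict (h : A ⊆ F) : (M ↾ F).rk A = M.rk A := by
  simp [rk, restrict_eRk_eq _ h]

lemma rank_restrict (F : Set α) : (M ↾ F).rank = M.rk F := by
  simp [rank, rk, restrict_eRk_eq _ (subset_refl F)]

lemma rk_contract (F X : Set α) : (M ／ F).rk X + M.rk F = M.rk (X ∪ F) := by
  obtain ⟨J, hJ⟩ := M.exists_isBasis' F
  obtain ⟨I, hI, hJI⟩ := hJ.indep.subset_isBasis'_of_subset (hJ.subset.trans Set.subset_union_right)
    (X := X ∪ F)
  have hIF : I ∩ F = J :=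
    (hJ.eq_of_subset_indep (hI.indep.subset Set.inter_subset_left)
      (Set.subset_inter hJI hJ.subset) Set.inter_subset_right).symm
  have h1 := hI.contract_isBasis' hJ (hI.indep.subset (Set.union_subset Set.sdiff_subset hJI))
  have h2 : (M ／ F).eRk X = (I \ F).encard := by
    rw [← h1.eRk_eq_encard, ← eRk_inter_ground, ← (M ／ F).eRk_inter_ground ((X ∪ F) \ F)]
    congr 1
    ext e
    simp only [contract_ground, Set.mem_inter_iff, Set.mem_sdiff, Set.mem_union]
    tauto
  have h3 : ((M ／ F).rk X + M.rk F : ℕ) = (M.rk (X ∪ F) : ℕ∞) := by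
    push_cast
    rw [coe_rk, coe_rk, coe_rk, h2, hI.eRk_eq_encard, hJ.eRk_eq_encard, ← hIF,
      Set.encard_sdiff_add_encard_inter]
  exact_mod_cast h3

lemma rank_contract (h : F ⊆ M.E) : (M ／ F).rank + M.rk F = M.rank := by
  rw [rank, rk_contract, contract_ground, Set.sdiff_union_of_subset h, rank]

lemma isFlat_restrict_iff (hG : M.IsFlat G) : (M ↾ G).IsFlat F ↔ M.IsFlat F ∧ F ⊆ G := by
  constructor
  · intro h
    have hs : F ⊆ G := h.subset_ground
    refine ⟨?_, hs⟩
    rw [isFlat_iff_closure_eq] at h ⊢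
    rw [restrict_closure_eq _ hs hG.subset_ground] at h
    rw [Set.inter_eq_left.2] at h
    · exact h
    · exact (M.closure_subset_closure hs).trans hG.closure.subset
  · rintro ⟨h, hs⟩
    rw [isFlat_iff_closure_eq, restrict_closure_eq _ hs hG.subset_ground, h.closure,
      Set.inter_eq_left.2 hs]

lemma isFlat_contract_iff (hF : F ⊆ M.E) {X : Set α} :
    (M ／ F).IsFlat X ↔ M.IsFlat (X ∪ F) ∧ Disjoint X F := by
  rw [isFlat_iff_closure_eq, isFlat_iff_closure_eq, contract_closure_eq]
  constructor
  · intro h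
    have hd : Disjoint X F := by rw [← h]; exact Set.disjoint_sdiff_left
    refine ⟨?_, hd⟩
    have : F ⊆ M.closure (X ∪ F) := M.subset_closure_of_subset' Set.subset_union_right hF
    rw [← Set.sdiff_union_of_subset this, h]
  · rintro ⟨h, hd⟩
    rw [h, Set.union_sdiff_right, hd.sdiff_eq_left]

end basics

section relaxation

lemma relaxation_exchange (M : Matroid α) [M.Finite] (H : Set α) (hH : M.IsStressedHyperplane H) :
    ExchangeProperty fun B => M.IsBase B ∨ (B ⊆ H ∧ B.ncard = M.rank) := by
  have card : ∀ B, M.IsBase B → B.ncard = M.rank := by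
    intro B hB
    have : (B.ncard : ℕ∞) = M.rank := by
      rw [hB.finite.cast_ncard_eq, hB.encard_eq_eRank, coe_rank]
    exact_mod_cast this
  have hHE : H ⊆ M.E := hH.1.1.subset_ground
  have hsub : ∀ B, (M.IsBase B ∨ (B ⊆ H ∧ B.ncard = M.rank)) → B ⊆ M.E := by
    rintro B (hB | hB)
    · exact hB.subset_ground
    · exact hB.1.trans hHE
  intro B₁ B₂ h₁ h₂ x hx
  have hfin₁ : B₁.Finite := M.set_finite B₁ (hsub _ h₁)
  have hfin₂ : B₂.Finite := M.set_finite B₂ (hsub _ h₂)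
  have c₁ : B₁.ncard = M.rank := h₁.elim (card _) And.right
  have c₂ : B₂.ncard = M.rank := h₂.elim (card _) And.right
  have hI : M.Indep (B₁ \ {x}) := by
    rcases h₁ with h₁ | h₁
    · exact h₁.indep.subset Set.sdiff_subset
    · exact (hH.2 B₁ h₁.1 h₁.2).sdiff_singleton_indep hx.1
  have cI : (B₁ \ {x}).ncard + 1 = M.rank := by
    rw [Set.ncard_sdiff_singleton_add_one hx.1 hfin₁, c₁]
  by_cases hcl : B₂ ⊆ M.closure (B₁ \ {x})
  · -- both sets are subsets of the hyperplane
    have hrI : M.rk (B₁ \ {x}) + 1 = M.rank := by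
      have : (M.rk (B₁ \ {x}) : ℕ∞) = (B₁ \ {x}).ncard := by
        rw [coe_rk, hI.eRk_eq_encard, (hfin₁.sdiff).cast_ncard_eq]
      rw [← cI, Nat.cast_injective (R := ℕ∞) this]
    have hr₂ : M.rk B₂ + 1 ≤ M.rank := by
      rw [← hrI, ← M.rk_closure (B₁ \ {x})]
      exact Nat.succ_le_succ (M.rk_mono hcl)
    have h₂' : B₂ ⊆ H ∧ B₂.ncard = M.rank := by
      refine h₂.resolve_left fun hB => ?_
      have : (M.rk B₂ : ℕ∞) = M.rank := by rw [coe_rk, coe_rank, hB.eRk_eq_eRank]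
      have : M.rk B₂ = M.rank := by exact_mod_cast this
      omega
    have hrB : M.rk B₂ + 1 = M.rank := by
      have := (hH.2 B₂ h₂'.1 h₂'.2).eRk_add_one_eq
      rw [← coe_rk, ← hfin₂.cast_ncard_eq, c₂] at this
      exact_mod_cast this
    have e1 : M.closure B₂ = M.closure H := by
      refine (RankFinite.isRkFinite B₂).closure_eq_closure_of_subset_of_eRk_ge_eRk h₂'.1 ?_
      rw [← coe_rk, ← coe_rk]
      have := hH.1.2
      exact_mod_cast (by omega : M.rk H ≤ M.rk B₂)
    have e2 : M.closure B₂ = M.closure (M.closure (B₁ \ {x})) := by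
      refine (RankFinite.isRkFinite B₂).closure_eq_closure_of_subset_of_eRk_ge_eRk hcl ?_
      rw [← coe_rk, ← coe_rk, rk_closure]
      exact_mod_cast (by omega : M.rk (B₁ \ {x}) ≤ M.rk B₂)
    rw [closure_closure, e1, hH.1.1.closure] at e2
    have hIH : B₁ \ {x} ⊆ H := by
      rw [e2]
      exact M.subset_closure _ hI.subset_ground
    obtain ⟨y, hy₂, hy₁⟩ : ∃ y ∈ B₂, y ∉ B₁ := by
      by_contra! hcon
      have := Set.eq_of_subset_of_ncard_le hcon (by omega) hfin₁
      exact hx.2 (this ▸ hx.1)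
    refine ⟨y, ⟨hy₂, hy₁⟩, Or.inr ⟨Set.insert_subset (h₂'.1 hy₂) hIH, ?_⟩⟩
    rw [Set.ncard_insert_of_notMem (fun h => hy₁ h.1) hfin₁.sdiff, cI]
  · obtain ⟨y, hy₂, hy⟩ := Set.not_subset.1 hcl
    have hyE : y ∈ M.E := hsub _ h₂ hy₂
    have hyI := (hI.notMem_closure_iff hyE).1 hy
    have hyx : y ≠ x := fun h => hx.2 (h ▸ hy₂)
    refine ⟨y, ⟨hy₂, fun h => hyI.2 ⟨h, hyx⟩⟩, Or.inl ?_⟩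
    refine hyI.1.isBase_of_eRk_ge (hfin₁.sdiff.insert y) ?_
    rw [hyI.1.eRk_eq_encard, ← (hfin₁.sdiff.insert y).cast_ncard_eq,
      Set.ncard_insert_of_notMem hyI.2 hfin₁.sdiff, cI, coe_rank]

/-- The relaxation `M̃` of a stressed hyperplane `H` of a matroid `M` of rank `k`: the matroid on the
same ground set whose bases are the bases of `M` and the subsets of `H` of cardinality `k`. -/
def relaxation (M : Matroid α) [M.Finite] (H : Set α) (hH : M.IsStressedHyperplane H) :
    Matroid α :=
  Matroid.ofIsBaseOfFinite M.ground_finite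
    (fun B => M.IsBase B ∨ (B ⊆ H ∧ B.ncard = M.rank))
    (M.exists_isBase.imp fun _ hB => Or.inl hB)
    (relaxation_exchange M H hH)
    (fun _ hB => hB.elim (fun h => h.subset_ground) fun h => h.1.trans hH.1.1.subset_ground)

@[simp] lemma relaxation_ground (M : Matroid α) [M.Finite] (H : Set α)
    (hH : M.IsStressedHyperplane H) : (M.relaxation H hH).E = M.E := rfl

@[simp] lemma relaxation_isBase_iff (M : Matroid α) [M.Finite] (H : Set α)
    (hH : M.IsStressedHyperplane H) (B : Set α) :
    (M.relaxation H hH).IsBase B ↔ M.IsBase B ∨ (B ⊆ H ∧ B.ncard = M.rank) := Iff.rfl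

instance relaxation_finite (M : Matroid α) [M.Finite] (H : Set α)
    (hH : M.IsStressedHyperplane H) : (M.relaxation H hH).Finite := ⟨M.ground_finite⟩

end relaxation


section kernel

/-- The subsets of the ground set of a finite matroid. -/
noncomputable def subsetsFinset (M : Matroid α) [M.Finite] : Finset (Set α) :=
  M.ground_finite.finite_subsets.toFinset

/-- The flats of a finite matroid. -/
noncomputable def flatsFinset (M : Matroid α) [M.Finite] : Finset (Set α) :=
  (M.ground_finite.finite_subsets.subset
    (fun _ hF => IsFlat.subset_ground hF : {F | M.IsFlat F} ⊆ {F | F ⊆ M.E})).toFinset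

variable (M : Matroid α) [M.Finite] {A B F G : Set α}

@[simp] lemma mem_subsetsFinset : A ∈ M.subsetsFinset ↔ A ⊆ M.E := by
  simp [subsetsFinset]

@[simp] lemma mem_flatsFinset : F ∈ M.flatsFinset ↔ M.IsFlat F := by
  simp [flatsFinset]

lemma finsum_flats (f : Set α → ℤ[X]) :
    ∑ᶠ (F : Set α) (_ : M.IsFlat F), f F = ∑ F ∈ M.flatsFinset, f F :=
  finsum_mem_eq_finite_toFinset_sum f (M.ground_finite.finite_subsets.subset
    (fun _ hF => IsFlat.subset_ground hF : {F | M.IsFlat F} ⊆ {F | F ⊆ M.E}))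

lemma charPoly_eq_sum :
    M.charPoly = ∑ A ∈ M.subsetsFinset, (-1) ^ A.ncard * X ^ (M.rank - M.rk A) :=
  finsum_mem_eq_finite_toFinset_sum _ M.ground_finite.finite_subsets

lemma natDegree_charPoly_le : M.charPoly.natDegree ≤ M.rank := by
  rw [charPoly_eq_sum]
  refine natDegree_sum_le_of_forall_le _ _ fun A _ => ?_
  have : ((-1 : ℤ[X]) ^ A.ncard) = C ((-1) ^ A.ncard) := by simp
  rw [this]
  exact (natDegree_C_mul_X_pow_le _ _).trans (Nat.sub_le _ _)

lemma finite_restrict (h : F ⊆ M.E) : (M ↾ F).Finite := ⟨M.set_finite F h⟩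

open Classical in
lemma reflect_charPoly_restrict (h : F ⊆ M.E) :
    (M ↾ F).charPoly.reflect (M.rk F) =
      ∑ A ∈ M.subsetsFinset with A ⊆ F, (-1) ^ A.ncard * X ^ M.rk A := by
  have := M.finite_restrict h
  rw [charPoly_eq_sum]
  have hadd : ∀ (s : Finset (Set α)) (f : Set α → ℤ[X]),
      (∑ A ∈ s, f A).reflect (M.rk F) = ∑ A ∈ s, (f A).reflect (M.rk F) := by
    intro s f
    induction s using Finset.induction_on with
    | empty => simp
    | insert a s ha ih => rw [Finset.sum_insert ha, Finset.sum_insert ha, reflect_add, ih]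
  rw [hadd]
  have hs : (M ↾ F).subsetsFinset = M.subsetsFinset.filter (· ⊆ F) := by
    ext A
    simp only [mem_subsetsFinset, restrict_ground_eq, Finset.mem_filter]
    exact ⟨fun hA => ⟨hA.trans h, hA⟩, And.right⟩
  rw [hs]
  refine Finset.sum_congr rfl fun A hA => ?_
  have hAF : A ⊆ F := (Finset.mem_filter.1 hA).2
  have hr := M.rk_mono hAF
  have : ((-1 : ℤ[X]) ^ A.ncard) = C ((-1) ^ A.ncard) := by simp
  rw [this, reflect_C_mul_X_pow, rank_restrict, rk_restrict _ hAF, revAt_le (Nat.sub_le _ _),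
    Nat.sub_sub_self hr]

open Classical in
lemma charPoly_contract (h : F ⊆ M.E) :
    (M ／ F).charPoly = ∑ B ∈ M.subsetsFinset with B ⊆ M.E \ F,
      (-1) ^ B.ncard * X ^ (M.rank - M.rk (B ∪ F)) := by
  rw [charPoly_eq_sum]
  have hs : (M ／ F).subsetsFinset = M.subsetsFinset.filter (· ⊆ M.E \ F) := by
    ext A
    simp only [mem_subsetsFinset, contract_ground, Finset.mem_filter]
    exact ⟨fun hA => ⟨hA.trans Set.sdiff_subset, hA⟩, And.right⟩
  rw [hs]
  refine Finset.sum_congr rfl fun A hA => ?_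
  have h1 := M.rank_contract h
  have h2 := M.rk_contract F A
  congr 2
  omega

open Classical in
lemma sum_sign {D : Set α} (hD : D ⊆ M.E) :
    ∑ B ∈ M.subsetsFinset with B ⊆ D, (-1 : ℤ[X]) ^ B.ncard = if D = ∅ then 1 else 0 := by
  have hfin := M.set_finite D hD
  have h1 : ∑ B ∈ M.subsetsFinset with B ⊆ D, (-1 : ℤ[X]) ^ B.ncard =
      ∑ S ∈ hfin.toFinset.powerset, (-1 : ℤ[X]) ^ S.card := by
    symm
    refine Finset.sum_bij (fun S _ => (S : Set α)) ?_ ?_ ?_ ?_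
    · intro S hS
      have : (S : Set α) ⊆ D := by
        intro x hx
        simpa using Finset.mem_powerset.1 hS hx
      simp [this, this.trans hD]
    · intro S _ T _ h
      exact_mod_cast h
    · intro B hB
      have hB' : B ⊆ D := (Finset.mem_filter.1 hB).2
      refine ⟨(hfin.subset hB').toFinset, ?_, by simp⟩
      simp [hB']
    · intro S _
      simp
  rw [h1]
  have h2 := congrArg (Int.cast (R := ℤ[X])) (Finset.sum_powerset_neg_one_pow_card
    (x := hfin.toFinset))
  push_cast at h2
  rw [h2]
  simp

lemma closure_union_subset_iff {K : Set α} (hK : M.IsFlat K) (hB : B ⊆ M.E) (hF : F ⊆ M.E) :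
    M.closure (B ∪ F) ⊆ K ↔ B ⊆ K ∧ F ⊆ K := by
  rw [← Set.union_subset_iff]
  constructor
  · intro h
    exact (M.subset_closure _ (Set.union_subset hB hF)).trans h
  · intro h
    exact (M.closure_subset_closure h).trans hK.closure.subset

open Classical in
/-- The characteristic polynomial is a kernel in the sense of Stanley. -/
lemma kernel (hE : M.E ≠ ∅) :
    ∑ F ∈ M.flatsFinset, (M ↾ F).charPoly.reflect (M.rk F) * (M ／ F).charPoly = 0 := by
  have hL : ∀ F : M.flatsFinset, M.IsFlat F.1 := fun F => M.mem_flatsFinset.1 F.2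
  have hLE : ∀ F : M.flatsFinset, F.1 ⊆ M.E := fun F => (hL F).subset_ground
  obtain ⟨cl, hcl⟩ : ∃ cl : Set α → M.flatsFinset, ∀ A, (cl A).1 = M.closure A :=
    ⟨fun A => ⟨M.closure A, by simp⟩, fun _ => rfl⟩
  obtain ⟨Z, hZ⟩ : ∃ Z : Matrix M.flatsFinset M.flatsFinset ℤ[X],
      ∀ F G, Z F G = if F.1 ⊆ G.1 then 1 else 0 := ⟨fun F G => _, fun _ _ => rfl⟩
  obtain ⟨W, hW⟩ : ∃ W : Matrix M.flatsFinset M.flatsFinset ℤ[X],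
      ∀ F G, W F G = ∑ B ∈ M.subsetsFinset with B ⊆ M.E \ F.1,
        if cl (B ∪ F.1) = G then (-1) ^ B.ncard else 0 := ⟨fun F G => _, fun _ _ => rfl⟩
  have hsum : ∀ (F : M.flatsFinset) (g : M.flatsFinset → ℤ[X]), ∑ G, W F G * g G =
      ∑ B ∈ M.subsetsFinset with B ⊆ M.E \ F.1, (-1) ^ B.ncard * g (cl (B ∪ F.1)) := by
    intro F g
    simp only [hW, Finset.sum_mul]
    rw [Finset.sum_comm]
    refine Finset.sum_congr rfl fun B _ => ?_
    simp
  have hWZ : W * Z = 1 := by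
    ext1 F K
    rw [Matrix.mul_apply, hsum F (fun G => Z G K), Matrix.one_apply]
    have h1 : ∑ B ∈ M.subsetsFinset with B ⊆ M.E \ F.1,
        (-1 : ℤ[X]) ^ B.ncard * Z (cl (B ∪ F.1)) K =
        if F.1 ⊆ K.1 then
          ∑ B ∈ M.subsetsFinset with B ⊆ K.1 \ F.1, (-1 : ℤ[X]) ^ B.ncard else 0 := by
      split_ifs with hFK
      · have : M.subsetsFinset.filter (· ⊆ K.1 \ F.1) =
            (M.subsetsFinset.filter (· ⊆ M.E \ F.1)).filter (· ⊆ K.1) := by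
          ext B
          simp only [Finset.mem_filter, Set.subset_sdiff]
          tauto
        rw [this, Finset.sum_filter _ (fun B : Set α => (-1 : ℤ[X]) ^ B.ncard)]
        refine Finset.sum_congr rfl fun B hB => ?_
        have hBE : B ⊆ M.E := by simpa using (Finset.mem_filter.1 hB).1
        simp only [hZ, hcl, M.closure_union_subset_iff (hL K) hBE (hLE F), hFK, and_true]
        simp
      · refine Finset.sum_eq_zero fun B hB => ?_
        have hBE : B ⊆ M.E := by simpa using (Finset.mem_filter.1 hB).1
        simp only [hZ, hcl, M.closure_union_subset_iff (hL K) hBE (hLE F), hFK, and_false]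
        simp
    rw [h1, M.sum_sign (Set.sdiff_subset.trans (hLE K))]
    by_cases h : F = K
    · subst h; simp
    · rw [if_neg h]
      split_ifs with h2 h3
      · exact absurd (Subtype.ext (h2.antisymm (Set.sdiff_eq_empty.1 h3))) h
      · rfl
      · rfl
  have hZW : Z * W = 1 := mul_eq_one_comm.1 hWZ
  have ha : ∀ F : M.flatsFinset, (M ↾ F.1).charPoly.reflect (M.rk F.1) =
      ∑ A ∈ M.subsetsFinset, (-1) ^ A.ncard * X ^ M.rk A * Z (cl A) F := by
    intro F
    rw [M.reflect_charPoly_restrict (hLE F), Finset.sum_filter]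
    refine Finset.sum_congr rfl fun A hA => ?_
    have hAE : A ⊆ M.E := by simpa using hA
    have := M.closure_union_subset_iff (hL F) hAE (Set.empty_subset _)
    rw [Set.union_empty] at this
    simp only [hZ, hcl, this, Set.empty_subset, and_true]
    simp
  have hb : ∀ F : M.flatsFinset, (M ／ F.1).charPoly = ∑ G, W F G * X ^ (M.rank - M.rk G.1) := by
    intro F
    rw [hsum, M.charPoly_contract (hLE F)]
    simp only [hcl, rk_closure]
  rw [← Finset.sum_coe_sort M.flatsFinset
    (fun F => (M ↾ F).charPoly.reflect (M.rk F) * (M ／ F).charPoly)]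
  calc ∑ F : M.flatsFinset, (M ↾ F.1).charPoly.reflect (M.rk F.1) * (M ／ F.1).charPoly
      = ∑ F : M.flatsFinset, ∑ A ∈ M.subsetsFinset, ∑ G : M.flatsFinset, (-1) ^ A.ncard * X ^ M.rk A *
          X ^ (M.rank - M.rk G.1) * (Z (cl A) F * W F G) := by
        refine Finset.sum_congr rfl fun F _ => ?_
        rw [ha, hb, Finset.sum_mul_sum]
        refine Finset.sum_congr rfl fun A _ => Finset.sum_congr rfl fun G _ => ?_
        ring
    _ = ∑ A ∈ M.subsetsFinset, ∑ G : M.flatsFinset, (-1) ^ A.ncard * X ^ M.rk A *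
          X ^ (M.rank - M.rk G.1) * (Z * W) (cl A) G := by
        rw [Finset.sum_comm]
        refine Finset.sum_congr rfl fun A _ => ?_
        rw [Finset.sum_comm]
        refine Finset.sum_congr rfl fun G _ => ?_
        rw [Matrix.mul_apply, Finset.mul_sum]
    _ = ∑ A ∈ M.subsetsFinset, (-1) ^ A.ncard * X ^ M.rank := by
        refine Finset.sum_congr rfl fun A _ => ?_
        rw [hZW]
        simp only [Matrix.one_apply, mul_ite, mul_one, mul_zero, Finset.sum_ite_eq,
          Finset.mem_univ, if_true, hcl, rk_closure]
        rw [mul_assoc, ← pow_add, Nat.add_sub_cancel' (M.rk_le_rank A)]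
    _ = 0 := by
        rw [← Finset.sum_mul]
        have := M.sum_sign (subset_refl M.E)
        rw [Finset.filter_true_of_mem (by simp), if_neg hE] at this
        rw [this, zero_mul]

end kernel


section existence

variable (M : Matroid α) [M.Finite] {A B F G : Set α}

lemma reflect_sum {ι : Type*} (n : ℕ) (s : Finset ι) (f : ι → ℤ[X]) :
    (∑ i ∈ s, f i).reflect n = ∑ i ∈ s, (f i).reflect n := by
  classical
  induction s using Finset.induction_on with
  | empty => simp
  | insert a s ha ih => rw [Finset.sum_insert ha, Finset.sum_insert ha, reflect_add, ih]

lemma reflect_neg_one_pow_mul (n k : ℕ) (p : ℤ[X]) :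
    ((-1) ^ k * p).reflect n = (-1) ^ k * p.reflect n := by
  have : ((-1 : ℤ[X]) ^ k) = C ((-1) ^ k) := by simp
  rw [this, reflect_C_mul]

/-- The part of a polynomial of degree less than `n / 2`. -/
noncomputable def lowerHalf (n : ℕ) (S : ℤ[X]) : ℤ[X] :=
  ∑ i ∈ Finset.range ((n + 1) / 2), monomial i (S.coeff i)

lemma coeff_lowerHalf (n : ℕ) (S : ℤ[X]) (i : ℕ) :
    (lowerHalf n S).coeff i = if 2 * i < n then S.coeff i else 0 := by
  simp only [lowerHalf, finsetSum_coeff, coeff_monomial, Finset.sum_ite_eq', Finset.mem_range]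
  congr 1
  apply propext
  omega

lemma natDegree_lowerHalf {n : ℕ} (hn : 0 < n) (S : ℤ[X]) : 2 * (lowerHalf n S).natDegree < n := by
  by_contra! h
  have h0 : lowerHalf n S ≠ 0 := by
    intro h0
    simp [h0] at h
    omega
  have := coeff_lowerHalf n S (lowerHalf n S).natDegree
  rw [if_neg (by omega)] at this
  exact h0 (leadingCoeff_eq_zero.1 this)

lemma reflect_lowerHalf {n : ℕ} {S : ℤ[X]} (h : S.reflect n = -S) :
    (-lowerHalf n S).reflect n = -lowerHalf n S + S := by
  ext i
  have hS : S.coeff (revAt n i) = - S.coeff i := by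
    rw [← coeff_reflect, h, coeff_neg]
  rw [coeff_reflect, coeff_add, coeff_neg, coeff_neg, coeff_lowerHalf, coeff_lowerHalf]
  rcases le_or_gt i n with hi | hi
  · rw [revAt_le hi] at hS ⊢
    rcases lt_trichotomy (2 * i) n with h1 | h1 | h1
    · rw [if_neg (by omega), if_pos h1]; ring
    · have : n - i = i := by omega
      rw [this] at hS
      rw [if_neg (by omega), if_neg (by omega)]; omega
    · rw [if_pos (by omega), if_neg (by omega)]; omega
  · rw [revAt_eq_self_of_lt hi] at hS ⊢
    have : S.coeff i = 0 := by omega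
    simp [this]

lemma eq_of_reflect_sub {n : ℕ} {p q : ℤ[X]} (hp : 2 * p.natDegree < n) (hq : 2 * q.natDegree < n)
    (h : p.reflect n - p = q.reflect n - q) : p = q := by
  ext i
  rcases lt_or_ge (2 * i) n with hi | hi
  · have h1 := congrArg (coeff · i) h
    simp only [coeff_sub, coeff_reflect] at h1
    rw [revAt_le (by omega), coeff_eq_zero_of_natDegree_lt (by omega),
      coeff_eq_zero_of_natDegree_lt (p := q) (by omega)] at h1
    omega
  · rw [coeff_eq_zero_of_natDegree_lt (by omega), coeff_eq_zero_of_natDegree_lt (by omega)]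

open Classical in
lemma sum_flats_contract (hF : F ⊆ M.E) (f : Set α → ℤ[X]) :
    ∑ Y ∈ (M ／ F).flatsFinset, f Y = ∑ G ∈ M.flatsFinset with F ⊆ G, f (G \ F) := by
  refine Finset.sum_bij' (fun Y _ => Y ∪ F) (fun G _ => G \ F) ?_ ?_ ?_ ?_ ?_
  · intro Y hY
    have := (M.isFlat_contract_iff hF).1 ((M ／ F).mem_flatsFinset.1 hY)
    simp [this.1]
  · intro G hG
    have hG' := Finset.mem_filter.1 hG
    rw [mem_flatsFinset, isFlat_contract_iff M hF, Set.sdiff_union_of_subset hG'.2]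
    exact ⟨M.mem_flatsFinset.1 hG'.1, Set.disjoint_sdiff_left⟩
  · intro Y hY
    have := (M.isFlat_contract_iff hF).1 ((M ／ F).mem_flatsFinset.1 hY)
    rw [Set.union_sdiff_right, this.2.sdiff_eq_left]
  · intro G hG
    exact Set.sdiff_union_of_subset (Finset.mem_filter.1 hG).2
  · intro Y hY
    have := (M.isFlat_contract_iff hF).1 ((M ／ F).mem_flatsFinset.1 hY)
    rw [Set.union_sdiff_right, this.2.sdiff_eq_left]

open Classical in
lemma sum_flats_restrict (hG : M.IsFlat G) [(M ↾ G).Finite] (f : Set α → ℤ[X]) :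
    ∑ Y ∈ (M ↾ G).flatsFinset, f Y = ∑ F ∈ M.flatsFinset with F ⊆ G, f F := by
  refine Finset.sum_congr ?_ fun _ _ => rfl
  ext F
  simp [isFlat_restrict_iff M hG]

open Classical in
lemma kernel_restrict (hG : M.IsFlat G) (hne : G ≠ ∅) :
    ∑ F ∈ M.flatsFinset with F ⊆ G,
      (M ↾ F).charPoly.reflect (M.rk F) * ((M ↾ G) ／ F).charPoly = 0 := by
  have := M.finite_restrict hG.subset_ground
  rw [← (M ↾ G).kernel (by simpa using hne), sum_flats_restrict M hG]
  refine Finset.sum_congr rfl fun F hF => ?_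
  have hFG := (Finset.mem_filter.1 hF).2
  rw [rk_restrict _ hFG, restrict_restrict_eq _ hFG]

open Classical in
lemma kernel_contract (hG : M.IsFlat G) (hne : G ≠ M.E) :
    ∑ F ∈ M.flatsFinset with G ⊆ F,
      ((M ↾ F) ／ G).charPoly.reflect (M.rk F - M.rk G) * (M ／ F).charPoly = 0 := by
  have hE : (M ／ G).E ≠ ∅ := by
    intro h
    rw [contract_ground, Set.sdiff_eq_empty] at h
    exact hne (hG.subset_ground.antisymm h)
  rw [← (M ／ G).kernel hE, sum_flats_contract M hG.subset_ground]
  refine Finset.sum_congr rfl fun F hF => ?_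
  have hGF := (Finset.mem_filter.1 hF).2
  have hr := M.rk_contract G (F \ G)
  rw [Set.sdiff_union_of_subset hGF] at hr
  rw [restrict_contract_eq_contract_restrict _ hGF, contract_contract,
    Set.union_sdiff_cancel hGF]
  congr 2
  omega

/-- Kazhdan--Lusztig polynomials, computed recursively. -/
noncomputable def klAux (M : Matroid α) : ℤ[X] :=
  open Classical in
  if M.E = ∅ then 1 else
    -lowerHalf M.rank (∑ᶠ F : Set α, if _h : M.IsFlat F ∧ (M ／ F).E.ncard < M.E.ncard then
      (M ↾ F).charPoly * klAux (M ／ F) else 0)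
termination_by M.E.ncard
decreasing_by exact _h.2

/-- Inverse Kazhdan--Lusztig polynomials, computed recursively. -/
noncomputable def invKLAux (M : Matroid α) : ℤ[X] :=
  open Classical in
  if M.E = ∅ then 1 else
    -lowerHalf M.rank ((-1) ^ M.rank *
      ∑ᶠ F : Set α, if _h : M.IsFlat F ∧ (M ↾ F).E.ncard < M.E.ncard then
        (-1) ^ M.rk F * invKLAux (M ↾ F) * (M ／ F).charPoly.reflect (M.rank - M.rk F) else 0)
termination_by M.E.ncard
decreasing_by exact _h.2

lemma rank_eq_zero_of_ground (h : M.E = ∅) : M.rank = 0 := by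
  simp [rank, rk, h]

open Classical in
lemma klAux_eq (hE : M.E ≠ ∅) : klAux M = -lowerHalf M.rank
    (∑ F ∈ M.flatsFinset with F ≠ ∅, (M ↾ F).charPoly * klAux (M ／ F)) := by
  rw [klAux, if_neg hE]
  congr 2
  rw [finsum_eq_sum_of_support_subset (s := M.flatsFinset), Finset.sum_filter]
  · refine Finset.sum_congr rfl fun F hF => ?_
    have hF := M.mem_flatsFinset.1 hF
    have : (M ／ F).E.ncard < M.E.ncard ↔ F ≠ ∅ := by
      rw [contract_ground]
      constructor
      · rintro h rfl
        simp at h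
      · intro h
        obtain ⟨x, hx⟩ := Set.nonempty_iff_ne_empty.2 h
        exact Set.ncard_lt_ncard ⟨Set.sdiff_subset,
          fun hs => (hs (hF.subset_ground hx)).2 hx⟩ M.ground_finite
    simp only [hF, this, true_and, dite_eq_ite]
  · intro F hF
    simp only [Function.mem_support] at hF
    simp only [SetLike.mem_coe, mem_flatsFinset]
    by_contra h
    exact hF (dif_neg fun h' => h h'.1)

open Classical in
lemma invKLAux_eq (hE : M.E ≠ ∅) : invKLAux M = -lowerHalf M.rank ((-1) ^ M.rank *
    ∑ F ∈ M.flatsFinset with F ≠ M.E,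
      (-1) ^ M.rk F * invKLAux (M ↾ F) * (M ／ F).charPoly.reflect (M.rank - M.rk F)) := by
  rw [invKLAux, if_neg hE]
  congr 3
  rw [finsum_eq_sum_of_support_subset (s := M.flatsFinset), Finset.sum_filter]
  · refine Finset.sum_congr rfl fun F hF => ?_
    have hF := M.mem_flatsFinset.1 hF
    have : (M ↾ F).E.ncard < M.E.ncard ↔ F ≠ M.E := by
      rw [restrict_ground_eq]
      constructor
      · rintro h rfl
        simp at h
      · intro h
        exact Set.ncard_lt_ncard (hF.subset_ground.ssubset_of_ne h) M.ground_finite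
    simp only [hF, this, true_and, dite_eq_ite]
  · intro F hF
    simp only [Function.mem_support] at hF
    simp only [SetLike.mem_coe, mem_flatsFinset]
    by_contra h
    exact hF (dif_neg fun h' => h h'.1)

lemma klAux_zero (h : M.rank = 0) (hE : M.E ≠ ∅) : klAux M = 0 := by
  rw [klAux_eq M hE, h]
  simp [lowerHalf]

lemma invKLAux_zero (h : M.rank = 0) (hE : M.E ≠ ∅) : invKLAux M = 0 := by
  rw [invKLAux_eq M hE, h]
  simp [lowerHalf]

lemma klAux_degree (h : 0 < M.rank) : 2 * (klAux M).natDegree < M.rank := by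
  rw [klAux_eq M (fun hE => h.ne' (M.rank_eq_zero_of_ground hE)), natDegree_neg]
  exact natDegree_lowerHalf h _

lemma invKLAux_degree (h : 0 < M.rank) : 2 * (invKLAux M).natDegree < M.rank := by
  rw [invKLAux_eq M (fun hE => h.ne' (M.rank_eq_zero_of_ground hE)), natDegree_neg]
  exact natDegree_lowerHalf h _

lemma klAux_natDegree_le : (klAux M).natDegree ≤ M.rank := by
  rcases Nat.eq_zero_or_pos M.rank with h | h
  · by_cases hE : M.E = ∅
    · rw [klAux, if_pos hE]; simp
    · rw [klAux_zero M h hE]; simp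
  · have := klAux_degree M h
    omega

lemma invKLAux_natDegree_le : (invKLAux M).natDegree ≤ M.rank := by
  rcases Nat.eq_zero_or_pos M.rank with h | h
  · by_cases hE : M.E = ∅
    · rw [invKLAux, if_pos hE]; simp
    · rw [invKLAux_zero M h hE]; simp
  · have := invKLAux_degree M h
    omega

lemma charPoly_of_ground (h : M.E = ∅) : M.charPoly = 1 := by
  rw [charPoly_eq_sum]
  have : M.subsetsFinset = {∅} := by
    ext A
    simp [h]
  rw [this, Finset.sum_singleton, M.rank_eq_zero_of_ground h]
  simp

open Classical in
lemma klAux_reflect (n : ℕ) : ∀ M : Matroid α, ∀ [M.Finite], M.E.ncard = n →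
    (klAux M).reflect M.rank = ∑ F ∈ M.flatsFinset, (M ↾ F).charPoly * klAux (M ／ F) := by
  induction n using Nat.strong_induction_on with
  | _ n ih =>
  intro M _ hn
  by_cases hE : M.E = ∅
  · have hfl : M.flatsFinset = {∅} := by
      ext F
      rw [mem_flatsFinset, Finset.mem_singleton]
      constructor
      · intro h
        exact Set.subset_empty_iff.1 (hE ▸ h.subset_ground)
      · rintro rfl
        rw [← hE]
        exact M.ground_isFlat
    have : (M ↾ ∅).Finite := M.finite_restrict (Set.empty_subset _)
    rw [hfl, Finset.sum_singleton, M.rank_eq_zero_of_ground hE, contract_empty,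
      charPoly_of_ground (M ↾ ∅) rfl, klAux, if_pos hE]
    simp
  set S := ∑ F ∈ M.flatsFinset with F ≠ ∅, (M ↾ F).charPoly * klAux (M ／ F) with hS
  have hP : klAux M = -lowerHalf M.rank S := klAux_eq M hE
  have key : S.reflect M.rank = ∑ G ∈ M.flatsFinset with G ≠ ∅,
      klAux (M ／ G) * ∑ F ∈ M.flatsFinset with F ≠ ∅ ∧ F ⊆ G,
        (M ↾ F).charPoly.reflect (M.rk F) * ((M ↾ G) ／ F).charPoly := by
    have h1 : S.reflect M.rank = ∑ F ∈ M.flatsFinset with F ≠ ∅,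
        ∑ G ∈ M.flatsFinset with F ⊆ G, klAux (M ／ G) *
          ((M ↾ F).charPoly.reflect (M.rk F) * ((M ↾ G) ／ F).charPoly) := by
      rw [hS, reflect_sum]
      refine Finset.sum_congr rfl fun F hF => ?_
      obtain ⟨hF, hne⟩ := Finset.mem_filter.1 hF
      have hF := M.mem_flatsFinset.1 hF
      have hFE := hF.subset_ground
      have := M.finite_restrict hFE
      have hcard : (M ／ F).E.ncard < n := by
        rw [← hn, contract_ground]
        obtain ⟨x, hx⟩ := Set.nonempty_iff_ne_empty.2 hne
        exact Set.ncard_lt_ncard ⟨Set.sdiff_subset,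
          fun hs => (hs (hFE hx)).2 hx⟩ M.ground_finite
      have hr : M.rank = (M ↾ F).rank + (M ／ F).rank := by
        rw [rank_restrict, ← M.rank_contract hFE, add_comm]
      rw [hr, reflect_mul _ _ (natDegree_charPoly_le _) (klAux_natDegree_le _),
        ih _ hcard (M ／ F) rfl, sum_flats_contract M hFE, Finset.mul_sum, rank_restrict]
      refine Finset.sum_congr rfl fun G hG => ?_
      have hFG := (Finset.mem_filter.1 hG).2
      rw [contract_contract, Set.union_sdiff_cancel hFG,
        restrict_contract_eq_contract_restrict _ hFG]
      ring
    rw [h1]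
    simp only [Finset.mul_sum]
    refine Finset.sum_comm' fun F G => ?_
    simp only [Finset.mem_filter]
    constructor
    · rintro ⟨⟨a, b⟩, c, d⟩
      exact ⟨⟨a, b, d⟩, c, fun h => b (Set.subset_empty_iff.1 (h ▸ d))⟩
    · rintro ⟨⟨a, b, d⟩, c, _⟩
      exact ⟨⟨a, b⟩, c, d⟩
  by_cases h0 : M.IsFlat ∅
  · have hemp : (M ↾ ∅).Finite := M.finite_restrict (Set.empty_subset _)
    have hχ : (M ↾ ∅).charPoly = 1 := charPoly_of_ground _ rfl
    have hanti : S.reflect M.rank = -S := by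
      rw [key, hS, ← Finset.sum_neg_distrib]
      refine Finset.sum_congr rfl fun G hG => ?_
      obtain ⟨hG, hne⟩ := Finset.mem_filter.1 hG
      have hk := M.kernel_restrict (M.mem_flatsFinset.1 hG) hne
      have hsplit : M.flatsFinset.filter (· ⊆ G) =
          insert ∅ (M.flatsFinset.filter fun F => F ≠ ∅ ∧ F ⊆ G) := by
        ext F
        simp only [Finset.mem_filter, Finset.mem_insert, mem_flatsFinset]
        by_cases hF : F = ∅
        · subst hF; simp [h0]
        · simp [hF]
      rw [hsplit, Finset.sum_insert (by simp), hχ, contract_empty] at hk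
      have hr0 : M.rk ∅ = 0 := by simp [rk]
      rw [hr0, reflect_one, pow_zero, one_mul] at hk
      rw [eq_neg_of_add_eq_zero_right hk]
      ring
    rw [hP, reflect_lowerHalf hanti, ← hP]
    have hsplit : M.flatsFinset = insert ∅ (M.flatsFinset.filter (· ≠ ∅)) := by
      ext F
      simp only [Finset.mem_filter, Finset.mem_insert, mem_flatsFinset]
      by_cases hF : F = ∅
      · subst hF; simp [h0]
      · simp [hF]
    rw [hsplit, Finset.sum_insert (by simp), hχ, contract_empty, one_mul]
  · have hall : M.flatsFinset.filter (· ≠ ∅) = M.flatsFinset := by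
      refine Finset.filter_true_of_mem fun F hF h => h0 ?_
      rw [← h]
      exact M.mem_flatsFinset.1 hF
    have hz : S.reflect M.rank = 0 := by
      rw [key]
      refine Finset.sum_eq_zero fun G hG => ?_
      obtain ⟨hG, hne⟩ := Finset.mem_filter.1 hG
      have hk := M.kernel_restrict (M.mem_flatsFinset.1 hG) hne
      rw [← hall, Finset.filter_filter] at hk
      rw [hk, mul_zero]
    have hS0 : S = 0 := reflect_eq_zero_iff.1 hz
    rw [hall] at hS
    rw [hP, ← hS, hS0]
    simp [lowerHalf]

open Classical in
lemma invKLAux_reflect (n : ℕ) : ∀ M : Matroid α, ∀ [M.Finite], M.E.ncard = n →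
    (-1) ^ M.rank * (invKLAux M).reflect M.rank = ∑ F ∈ M.flatsFinset,
      (-1) ^ M.rk F * invKLAux (M ↾ F) * (M ／ F).charPoly.reflect (M.rank - M.rk F) := by
  induction n using Nat.strong_induction_on with
  | _ n ih =>
  intro M _ hn
  have hχ : (M ／ M.E).charPoly = 1 := charPoly_of_ground _ (by simp)
  have hrE : M.rk M.E = M.rank := rfl
  have hsplit : M.flatsFinset = insert M.E (M.flatsFinset.filter (· ≠ M.E)) := by
    ext F
    simp only [Finset.mem_filter, Finset.mem_insert, mem_flatsFinset]
    by_cases hF : F = M.E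
    · subst hF; simp
    · simp [hF]
  rw [hsplit, Finset.sum_insert (by simp), hχ, restrict_ground_eq_self, hrE, Nat.sub_self]
  by_cases hE : M.E = ∅
  · have hno : M.flatsFinset.filter (· ≠ M.E) = ∅ := by
      refine Finset.filter_false_of_mem fun F hF => ?_
      have := (M.mem_flatsFinset.1 hF).subset_ground
      rw [hE] at this ⊢
      simpa using this
    rw [hno, M.rank_eq_zero_of_ground hE, invKLAux, if_pos hE]
    simp
  set R := ∑ F ∈ M.flatsFinset with F ≠ M.E,
    (-1) ^ M.rk F * invKLAux (M ↾ F) * (M ／ F).charPoly.reflect (M.rank - M.rk F) with hR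
  have hQ : invKLAux M = -lowerHalf M.rank ((-1) ^ M.rank * R) := invKLAux_eq M hE
  have key : R.reflect M.rank = ∑ G ∈ M.flatsFinset with G ≠ M.E,
      (-1) ^ M.rk G * invKLAux (M ↾ G) * ∑ F ∈ M.flatsFinset with F ≠ M.E ∧ G ⊆ F,
        ((M ↾ F) ／ G).charPoly.reflect (M.rk F - M.rk G) * (M ／ F).charPoly := by
    have h1 : R.reflect M.rank = ∑ F ∈ M.flatsFinset with F ≠ M.E,
        ∑ G ∈ M.flatsFinset with G ⊆ F, (-1) ^ M.rk G * invKLAux (M ↾ G) *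
          (((M ↾ F) ／ G).charPoly.reflect (M.rk F - M.rk G) * (M ／ F).charPoly) := by
      rw [hR, reflect_sum]
      refine Finset.sum_congr rfl fun F hF => ?_
      obtain ⟨hF, hne⟩ := Finset.mem_filter.1 hF
      have hF := M.mem_flatsFinset.1 hF
      have hFE := hF.subset_ground
      have := M.finite_restrict hFE
      have hcard : (M ↾ F).E.ncard < n := by
        rw [← hn, restrict_ground_eq]
        exact Set.ncard_lt_ncard (hFE.ssubset_of_ne hne) M.ground_finite
      have hr : M.rank = (M ↾ F).rank + (M ／ F).rank := by
        rw [rank_restrict, ← M.rank_contract hFE, add_comm]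
      have hr' : M.rank - M.rk F = (M ／ F).rank := by
        rw [← M.rank_contract hFE, Nat.add_sub_cancel]
      have hrc : (((M ／ F).charPoly).reflect (M ／ F).rank).natDegree ≤ (M ／ F).rank :=
        natDegree_reflect_le.trans (max_le le_rfl (natDegree_charPoly_le _))
      rw [mul_assoc, reflect_neg_one_pow_mul, hr', hr, reflect_mul _ _ (invKLAux_natDegree_le _) hrc,
        reflect_reflect, ← mul_assoc, ← rank_restrict, ih _ hcard (M ↾ F) rfl,
        sum_flats_restrict M hF, Finset.sum_mul, rank_restrict]
      refine Finset.sum_congr rfl fun G hG => ?_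
      have hGF := (Finset.mem_filter.1 hG).2
      rw [rk_restrict _ hGF, restrict_restrict_eq _ hGF]
      ring
    rw [h1]
    simp only [Finset.mul_sum]
    refine Finset.sum_comm' fun F G => ?_
    simp only [Finset.mem_filter, mem_flatsFinset]
    constructor
    · rintro ⟨⟨a, b⟩, c, d⟩
      exact ⟨⟨a, b, d⟩, c, fun h => b (a.subset_ground.antisymm (h ▸ d))⟩
    · rintro ⟨⟨a, b, d⟩, c, _⟩
      exact ⟨⟨a, b⟩, c, d⟩
  have hanti : R.reflect M.rank = -R := by
    rw [key, hR, ← Finset.sum_neg_distrib]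
    refine Finset.sum_congr rfl fun G hG => ?_
    obtain ⟨hG, hne⟩ := Finset.mem_filter.1 hG
    have hG := M.mem_flatsFinset.1 hG
    have hk := M.kernel_contract hG hne
    have hsplit' : M.flatsFinset.filter (G ⊆ ·) =
        insert M.E (M.flatsFinset.filter fun F => F ≠ M.E ∧ G ⊆ F) := by
      ext F
      simp only [Finset.mem_filter, Finset.mem_insert, mem_flatsFinset]
      by_cases hF : F = M.E
      · subst hF; simp [hG.subset_ground]
      · simp [hF]
    rw [hsplit', Finset.sum_insert (by simp), hχ, restrict_ground_eq_self, hrE, mul_one] at hk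
    rw [← neg_eq_iff_add_eq_zero.2 hk]
    ring
  have hanti' : ((-1) ^ M.rank * R).reflect M.rank = -((-1) ^ M.rank * R) := by
    rw [reflect_neg_one_pow_mul, hanti, mul_neg]
  have h1 : ((-1 : ℤ[X]) ^ M.rank) * (-1) ^ M.rank = 1 := by
    rw [← mul_pow]; simp
  rw [hQ, reflect_lowerHalf hanti', ← hQ, mul_add, ← mul_assoc, h1]
  simp

theorem exists_isKLFamily : ∃ P : Matroid α → ℤ[X], IsKLFamily P := by
  refine ⟨klAux, ?_, ?_, ?_, ?_⟩
  · intro M _ _ hE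
    rw [klAux, if_pos hE]
  · intro M _ h hE
    exact klAux_zero M h hE
  · intro M _ h
    exact klAux_degree M h
  · intro M _
    rw [finsum_flats]
    exact klAux_reflect _ M rfl

theorem exists_isInvKLFamily : ∃ Q : Matroid α → ℤ[X], IsInvKLFamily Q := by
  refine ⟨invKLAux, ?_, ?_, ?_, ?_⟩
  · intro M _ _ hE
    rw [invKLAux, if_pos hE]
  · intro M _ h hE
    exact invKLAux_zero M h hE
  · intro M _ h
    exact invKLAux_degree M h
  · intro M _
    rw [finsum_flats M fun F => (-1) ^ M.rk F * invKLAux (M ↾ F) *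
      (M ／ F).charPoly.reflect (M.rank - M.rk F)]
    exact invKLAux_reflect _ M rfl

open Classical in
theorem IsKLFamily.unique {P P' : Matroid α → ℤ[X]} (hP : IsKLFamily P) (hP' : IsKLFamily P')
    (M : Matroid α) [hM : M.Finite] : P M = P' M := by
  induction hn : M.E.ncard using Nat.strong_induction_on generalizing M with
  | _ n ih =>
  rcases Nat.eq_zero_or_pos M.rank with h | h
  · by_cases hE : M.E = ∅
    · rw [hP.eq_one M hM h hE, hP'.eq_one M hM h hE]
    · rw [hP.eq_zero M hM h hE, hP'.eq_zero M hM h hE]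
  have e := hP.reflect_eq M hM
  have e' := hP'.reflect_eq M hM
  rw [finsum_flats M fun F => (M ↾ F).charPoly * P (M ／ F)] at e
  rw [finsum_flats M fun F => (M ↾ F).charPoly * P' (M ／ F)] at e'
  have hS : ∑ F ∈ M.flatsFinset with F ≠ ∅, (M ↾ F).charPoly * P (M ／ F) =
      ∑ F ∈ M.flatsFinset with F ≠ ∅, (M ↾ F).charPoly * P' (M ／ F) := by
    refine Finset.sum_congr rfl fun F hF => ?_
    obtain ⟨hF, hne⟩ := Finset.mem_filter.1 hF
    have hFE := (M.mem_flatsFinset.1 hF).subset_ground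
    obtain ⟨x, hx⟩ := Set.nonempty_iff_ne_empty.2 hne
    rw [ih _ (hn ▸ Set.ncard_lt_ncard ⟨Set.sdiff_subset, fun hs => (hs (hFE hx)).2 hx⟩
      M.ground_finite) (M ／ F) rfl]
  rw [← Finset.sum_filter_add_sum_filter_not _ (· ≠ ∅)] at e e'
  rw [hS] at e
  by_cases h0 : M.IsFlat ∅
  · have hs : M.flatsFinset.filter (fun F => ¬ F ≠ ∅) = {∅} := by
      ext F
      simp only [Finset.mem_filter, mem_flatsFinset, Finset.mem_singleton, not_not]
      exact ⟨And.right, fun hF => ⟨hF ▸ h0, hF⟩⟩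
    have := M.finite_restrict (Set.empty_subset M.E)
    rw [hs, Finset.sum_singleton, charPoly_of_ground (M ↾ ∅) rfl, contract_empty, one_mul] at e e'
    refine eq_of_reflect_sub (hP.degree_lt M hM h) (hP'.degree_lt M hM h) ?_
    rw [e, e']
    ring
  · have hs : M.flatsFinset.filter (fun F => ¬ F ≠ ∅) = ∅ := by
      refine Finset.filter_false_of_mem fun F hF hne => h0 ?_
      rw [← not_not.1 hne]
      exact M.mem_flatsFinset.1 hF
    rw [hs, Finset.sum_empty] at e e'
    rw [← reflect_reflect (N := M.rank) (p := P M), e, ← e', reflect_reflect]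

open Classical in
theorem IsInvKLFamily.unique {Q Q' : Matroid α → ℤ[X]} (hQ : IsInvKLFamily Q)
    (hQ' : IsInvKLFamily Q') (M : Matroid α) [hM : M.Finite] : Q M = Q' M := by
  induction hn : M.E.ncard using Nat.strong_induction_on generalizing M with
  | _ n ih =>
  rcases Nat.eq_zero_or_pos M.rank with h | h
  · by_cases hE : M.E = ∅
    · rw [hQ.eq_one M hM h hE, hQ'.eq_one M hM h hE]
    · rw [hQ.eq_zero M hM h hE, hQ'.eq_zero M hM h hE]
  have e := hQ.reflect_eq M hM
  have e' := hQ'.reflect_eq M hM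
  rw [finsum_flats M fun F => (-1) ^ M.rk F * Q (M ↾ F) *
    (M ／ F).charPoly.reflect (M.rank - M.rk F)] at e
  rw [finsum_flats M fun F => (-1) ^ M.rk F * Q' (M ↾ F) *
    (M ／ F).charPoly.reflect (M.rank - M.rk F)] at e'
  have hS : ∑ F ∈ M.flatsFinset with F ≠ M.E, (-1) ^ M.rk F * Q (M ↾ F) *
        (M ／ F).charPoly.reflect (M.rank - M.rk F) =
      ∑ F ∈ M.flatsFinset with F ≠ M.E, (-1) ^ M.rk F * Q' (M ↾ F) *
        (M ／ F).charPoly.reflect (M.rank - M.rk F) := by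
    refine Finset.sum_congr rfl fun F hF => ?_
    obtain ⟨hF, hne⟩ := Finset.mem_filter.1 hF
    have hFE := (M.mem_flatsFinset.1 hF).subset_ground
    have := M.finite_restrict hFE
    rw [ih _ (hn ▸ Set.ncard_lt_ncard (hFE.ssubset_of_ne hne) M.ground_finite) (M ↾ F) rfl]
  rw [← Finset.sum_filter_add_sum_filter_not _ (· ≠ M.E)] at e e'
  rw [hS] at e
  have hs : M.flatsFinset.filter (fun F => ¬ F ≠ M.E) = {M.E} := by
    ext F
    simp only [Finset.mem_filter, mem_flatsFinset, Finset.mem_singleton, not_not]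
    exact ⟨And.right, fun hF => ⟨hF ▸ M.ground_isFlat, hF⟩⟩
  have hrE : M.rk M.E = M.rank := rfl
  rw [hs, Finset.sum_singleton, charPoly_of_ground (M ／ M.E) (by simp), hrE, Nat.sub_self,
    reflect_one, pow_zero, mul_one, restrict_ground_eq_self] at e e'
  refine eq_of_reflect_sub (hQ.degree_lt M hM h) (hQ'.degree_lt M hM h) ?_
  have h1 : ((-1 : ℤ[X]) ^ M.rank) ≠ 0 := pow_ne_zero _ (by simp)
  refine mul_left_cancel₀ h1 ?_
  linear_combination e - e'

end existence

/-- The Kazhdan--Lusztig polynomial `P_M` of a finite matroid: the unique assignment satisfying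
`IsKLFamily`. -/
noncomputable def klPoly (M : Matroid α) : ℤ[X] :=
  (exists_isKLFamily (α := α)).choose M

/-- The inverse Kazhdan--Lusztig polynomial `Q_M` of a finite matroid: the unique assignment
satisfying `IsInvKLFamily`. -/
noncomputable def invKLPoly (M : Matroid α) : ℤ[X] :=
  (exists_isInvKLFamily (α := α)).choose M

/-- The `Z`-polynomial `Z_M(t) = ∑_F t^rk(F) P_{M_F}(t)` of a finite matroid, the sum over all
flats `F` of `M`. -/
noncomputable def zPoly (M : Matroid α) : ℤ[X] :=
  ∑ᶠ (F : Set α) (_ : M.IsFlat F), X ^ M.rk F * (M ／ F).klPoly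


end Matroid

/-! Let `M` have rank `m + 1`, let `H` be a stressed hyperplane with more than `m` elements, and let
`N` be the relaxation. Passing from `M` to `N` changes only the ranks of subsets of `H`, from `min
|A| m` to `min |A| (m + 1)`. `IsRelaxationPair` records exactly this; in this form the relation
passes directly to contractions by subsets of `H` with fewer than `m` elements.

Flats not contained in `H` are the same for both matroids, with equal contractions and, apart from
the ground set, equal restrictions. Inside `H`, the flats of `M` are the sets with fewer than `m`
elements and `H` itself; those of `N` are the sets with at most `m` elements. So when the defining
sums over flats are subtracted, everything outside `H` cancels except the term of the ground set
(`sum_flats_sub`). The terms inside `H` involve Boolean and uniform restrictions, contractions of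
rank one, and smaller relaxation pairs. They depend only on cardinalities, so they add up to
binomial sums in `m` and `|H|`.

For `P` and `Q` this gives `D.reflect (m + 1) = D + R` for the difference `D`, with `R` determined
by `m` and `|H|` (for `P` when `m > 0`). Since `D` has degree less than `(m + 1) / 2`, it is minus
the lower half of `R` (`eq_neg_lowerHalf`). For `P` the smaller pairs are handled by induction on
`m`. For `Q` no such induction is needed: contractions enter only through characteristic
polynomials, and restrictions to proper flats inside `H` are uniform, so `exists_invKLPoly_uniform`
suffices. The result for `Z` follows by substituting that for `P` in its definition. If `|H| ≤ m`,
the relaxation is `M` itself. -/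

namespace Matroid

variable {α : Type*}

/-! ### Rank, closure and flats with natural-number ranks -/

section rank

variable (M : Matroid α) [M.Finite] {A B F : Set α} {e : α}

lemma rk_empty : M.rk ∅ = 0 := by simp [rk]

lemma indep_iff_rk_eq_ncard (hA : A ⊆ M.E) : M.Indep A ↔ M.rk A = A.ncard := by
  rw [indep_iff_eRk_eq_encard, ← coe_rk, ← (M.set_finite A hA).cast_ncard_eq]
  norm_cast

lemma ext_rk {N : Matroid α} [N.Finite] (hE : M.E = N.E) (h : ∀ A ⊆ M.E, M.rk A = N.rk A) :
    M = N := by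
  refine ext_indep hE fun A hA => ?_
  rw [M.indep_iff_rk_eq_ncard hA, N.indep_iff_rk_eq_ncard (hE ▸ hA), h A hA]

lemma closure_eq_of_rk_le (h : A ⊆ B) (hr : M.rk B ≤ M.rk A) : M.closure A = M.closure B := by
  refine (RankFinite.isRkFinite A).closure_eq_closure_of_subset_of_eRk_ge_eRk h ?_
  rw [← coe_rk, ← coe_rk]
  exact_mod_cast hr

variable {M}

lemma IsFlat.rk_insert (hF : M.IsFlat F) (he : e ∈ M.E) (heF : e ∉ F) :
    M.rk (insert e F) = M.rk F + 1 := by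
  have := M.eRk_insert_eq_add_one (X := F) ⟨he, by rwa [hF.closure]⟩
  rw [← coe_rk, ← coe_rk] at this
  exact_mod_cast this

lemma IsFlat.eq_ground_of_rank_le (hF : M.IsFlat F) (h : M.rank ≤ M.rk F) : F = M.E := by
  rw [← hF.closure, M.closure_eq_of_rk_le hF.subset_ground h, closure_ground]

lemma isFlat_iff_rk_lt : M.IsFlat F ↔ F ⊆ M.E ∧ ∀ e ∈ M.E, e ∉ F → M.rk F < M.rk (insert e F) := by
  refine ⟨fun h => ⟨h.subset_ground, fun e he heF => by rw [h.rk_insert he heF]; omega⟩, ?_⟩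
  rintro ⟨hF, h⟩
  rw [isFlat_iff_closure_eq]
  refine (M.subset_closure F hF).antisymm' fun e he => ?_
  by_contra heF
  have h1 := h e (M.closure_subset_ground F he) heF
  have h2 := M.rk_mono (Set.insert_subset he (M.subset_closure F hF))
  rw [rk_closure] at h2
  omega

lemma IsBase.ncard_eq_rank (hB : M.IsBase B) : B.ncard = M.rank := by
  have : (B.ncard : ℕ∞) = M.rank := by
    rw [(M.set_finite B hB.subset_ground).cast_ncard_eq, hB.encard_eq_eRank, coe_rank]
  exact_mod_cast this

end rank

/-! ### Sums over subsets, and uniform matroids -/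

section sums

variable (M : Matroid α) [M.Finite]

open Classical in
-- This is what turns sums over subsets of a stressed hyperplane into expressions that see only its
-- cardinality.
lemma sum_subsets_ncard {D : Set α} (hD : D ⊆ M.E) (f : ℕ → ℤ[X]) :
    ∑ A ∈ M.subsetsFinset with A ⊆ D, f A.ncard =
      ∑ j ∈ Finset.range (D.ncard + 1), D.ncard.choose j • f j := by
  have hfin := M.set_finite D hD
  rw [Set.ncard_eq_toFinset_card D hfin, ← Finset.sum_powerset_apply_card]
  symm
  refine Finset.sum_bij (fun S _ => (S : Set α)) ?_ ?_ ?_ ?_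
  · intro S hS
    have : (S : Set α) ⊆ D := by
      intro x hx
      simpa using Finset.mem_powerset.1 hS hx
    simp [this, this.trans hD]
  · intro S _ T _ h
    exact_mod_cast h
  · intro B hB
    have hB' : B ⊆ D := (Finset.mem_filter.1 hB).2
    refine ⟨(hfin.subset hB').toFinset, ?_, by simp⟩
    simp [hB']
  · intro S _
    simp

end sums

/-- The rank function of `M` is that of the uniform matroid of rank `min r n` on `n` elements. -/
structure IsUniform (M : Matroid α) (r n : ℕ) : Prop where
  ncard_ground : M.E.ncard = n
  rk_eq : ∀ A ⊆ M.E, M.rk A = min A.ncard r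

/-- The characteristic polynomial of the uniform matroid of rank `min r n` on `n` elements. -/
noncomputable def uniformCharPoly (r n : ℕ) : ℤ[X] :=
  ∑ j ∈ Finset.range (n + 1), n.choose j • ((-1) ^ j * X ^ (min n r - min j r))

section uniform

variable {M : Matroid α} [M.Finite] {r n : ℕ} {F : Set α}

lemma IsUniform.rank_eq (h : M.IsUniform r n) : M.rank = min n r := by
  rw [rank, h.rk_eq _ subset_rfl, h.ncard_ground]

lemma IsUniform.charPoly_eq (h : M.IsUniform r n) : M.charPoly = uniformCharPoly r n := by
  classical
  have := M.sum_subsets_ncard subset_rfl fun j => (-1) ^ j * X ^ (min n r - min j r)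
  rw [h.ncard_ground] at this
  rw [uniformCharPoly, ← this, charPoly_eq_sum, Finset.filter_true_of_mem (by simp)]
  refine Finset.sum_congr rfl fun A hA => ?_
  rw [h.rank_eq, h.rk_eq A (M.mem_subsetsFinset.1 hA)]

/-- Every nonempty set has full rank, so only the empty set contributes a positive power of `X`.
Comparison with the vanishing alternating sum over all subsets then gives the constant term,
whatever `n` is. -/
lemma IsUniform.charPoly_of_rank_one (h : M.IsUniform 1 n) (hn : n ≠ 0) :
    M.charPoly = X - 1 := by
  classical
  have hE : M.E ≠ ∅ := fun hE => hn (by rw [← h.ncard_ground, hE, Set.ncard_empty])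
  have hs := M.sum_sign (subset_refl M.E)
  rw [Finset.filter_true_of_mem (by simp), if_neg hE] at hs
  have : M.charPoly = (X - 1) + ∑ A ∈ M.subsetsFinset, (-1) ^ A.ncard := by
    rw [charPoly_eq_sum, ← sub_eq_iff_eq_add, ← Finset.sum_sub_distrib,
      Finset.sum_eq_single ∅]
    · simp [h.rank_eq, rk_empty, show min n 1 = 1 by omega]
    · intro A hA hne
      have hA := M.mem_subsetsFinset.1 hA
      have := (Set.ncard_pos (M.set_finite A hA)).2 (Set.nonempty_iff_ne_empty.2 hne)
      rw [h.rank_eq, h.rk_eq A hA, show min n 1 - min A.ncard 1 = 0 by omega]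
      simp
    · simp
  rw [this, hs, add_zero]

lemma IsUniform.restrict (h : M.IsUniform r n) (hF : F ⊆ M.E) (hr : F.ncard ≤ r) :
    (M ↾ F).IsUniform F.ncard F.ncard := by
  refine ⟨rfl, fun A hA => ?_⟩
  have hA : A ⊆ F := hA
  rw [rk_restrict M hA, h.rk_eq A (hA.trans hF)]
  have := Set.ncard_le_ncard hA (M.set_finite F hF)
  omega

lemma IsUniform.contract (h : M.IsUniform r n) (hF : F ⊆ M.E) (hr : F.ncard ≤ r) :
    (M ／ F).IsUniform (r - F.ncard) (n - F.ncard) := by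
  have hfin := M.set_finite F hF
  refine ⟨?_, fun A hA => ?_⟩
  · rw [contract_ground, Set.ncard_sdiff hF hfin, h.ncard_ground]
  have hA' : A ⊆ M.E ∧ Disjoint A F := Set.subset_sdiff.1 hA
  have h1 := M.rk_contract F A
  rw [h.rk_eq F hF, h.rk_eq _ (Set.union_subset hA'.1 hF),
    Set.ncard_union_eq hA'.2 (M.set_finite A hA'.1) hfin] at h1
  omega

/-- A set with at least `r` elements spans, while a smaller one gains rank with each new element.
The bound `r ≤ n` keeps the ground set out of the first alternative. -/
lemma IsUniform.isFlat_iff (h : M.IsUniform r n) (hr : r ≤ n) :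
    M.IsFlat F ↔ F ⊆ M.E ∧ (F.ncard < r ∨ F = M.E) := by
  constructor
  · intro hF
    refine ⟨hF.subset_ground, or_iff_not_imp_left.2 fun hlt => hF.eq_ground_of_rank_le ?_⟩
    rw [h.rank_eq, h.rk_eq F hF.subset_ground]
    omega
  · rintro ⟨hF, hlt | rfl⟩
    · refine isFlat_iff_rk_lt.2 ⟨hF, fun e he heF => ?_⟩
      rw [h.rk_eq F hF, h.rk_eq _ (Set.insert_subset he hF),
        Set.ncard_insert_of_notMem heF (M.set_finite F hF)]
      omega
    · exact M.ground_isFlat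

end uniform

/-! ### The recursions for `P`, `Q` and `Z`, and the uniform case -/

section polynomials

lemma isKLFamily_klPoly : IsKLFamily (klPoly (α := α)) :=
  (exists_isKLFamily (α := α)).choose_spec

lemma isInvKLFamily_invKLPoly : IsInvKLFamily (invKLPoly (α := α)) :=
  (exists_isInvKLFamily (α := α)).choose_spec

/-- For `2 * i < n`, the coefficient of `p.reflect n` at `i` is that of `p` at `n - i`, which is
zero by the degree bound. Hence `p` and `R` cancel in low degrees, and `p` has no other
coefficients. -/
lemma eq_neg_lowerHalf {n : ℕ} {p R : ℤ[X]} (hp : 2 * p.natDegree < n)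
    (h : p.reflect n = p + R) : p = -lowerHalf n R := by
  ext i
  rw [coeff_neg, coeff_lowerHalf]
  split_ifs with hi
  · have h1 := congrArg (coeff · i) h
    simp only [coeff_reflect, coeff_add] at h1
    rw [revAt_le (by omega), coeff_eq_zero_of_natDegree_lt (by omega)] at h1
    omega
  · rw [coeff_eq_zero_of_natDegree_lt (by omega), neg_zero]

variable (M : Matroid α) [hM : M.Finite]

lemma klPoly_reflect : M.klPoly.reflect M.rank =
    ∑ F ∈ M.flatsFinset, (M ↾ F).charPoly * (M ／ F).klPoly := by
  rw [isKLFamily_klPoly.reflect_eq M hM,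
    finsum_flats M fun F => (M ↾ F).charPoly * (M ／ F).klPoly]

lemma invKLPoly_reflect : (-1) ^ M.rank * M.invKLPoly.reflect M.rank =
    ∑ F ∈ M.flatsFinset, (-1) ^ M.rk F * (M ↾ F).invKLPoly *
      (M ／ F).charPoly.reflect (M.rank - M.rk F) := by
  rw [isInvKLFamily_invKLPoly.reflect_eq M hM, finsum_flats M fun F =>
    (-1) ^ M.rk F * (M ↾ F).invKLPoly * (M ／ F).charPoly.reflect (M.rank - M.rk F)]

lemma zPoly_eq_sum : M.zPoly = ∑ F ∈ M.flatsFinset, X ^ M.rk F * (M ／ F).klPoly :=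
  finsum_flats M fun F => X ^ M.rk F * (M ／ F).klPoly

lemma klPoly_contract_ground : (M ／ M.E).klPoly = 1 :=
  isKLFamily_klPoly.eq_one _ inferInstance ((M ／ M.E).rank_eq_zero_of_ground (by simp)) (by simp)

lemma charPoly_contract_ground : (M ／ M.E).charPoly = 1 :=
  charPoly_of_ground _ (by simp)

lemma natDegree_sub_lt {p q : ℤ[X]} {n : ℕ} (hp : 2 * p.natDegree < n) (hq : 2 * q.natDegree < n) :
    2 * (p - q).natDegree < n := by
  have := natDegree_sub_le p q
  omega

variable {M}

open Classical in
lemma IsUniform.sum_flats {r n : ℕ} (h : M.IsUniform r n) (hr : r ≤ n) (f : Set α → ℤ[X]) :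
    ∑ F ∈ M.flatsFinset, f F =
      ∑ A ∈ M.subsetsFinset with A ⊆ M.E, (if A.ncard < r then f A else 0) + f M.E := by
  have hE : M.E ∉ M.subsetsFinset.filter fun A => A.ncard < r := by
    simp [h.ncard_ground, hr]
  rw [Finset.filter_true_of_mem (by simp), ← Finset.sum_filter, add_comm, ← Finset.sum_insert hE]
  refine Finset.sum_congr ?_ fun _ _ => rfl
  ext F
  simp only [mem_flatsFinset, h.isFlat_iff hr, Finset.mem_insert, Finset.mem_filter,
    mem_subsetsFinset]
  constructor
  · tauto
  · rintro (rfl | h)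
    · exact ⟨subset_rfl, Or.inr rfl⟩
    · tauto

/-- The degree bound forces a constant `c`. The only flats are the empty set and the ground set, so
the recursion reads `c * X = c + (X - 1)`, and constant terms give `c = 1`. -/
lemma IsUniform.klPoly_of_rank_one {n : ℕ} (h : M.IsUniform 1 n) (hn : n ≠ 0) : M.klPoly = 1 := by
  classical
  have hr : M.rank = 1 := by rw [h.rank_eq]; omega
  have hdeg := isKLFamily_klPoly.degree_lt M hM (by omega)
  have e := M.klPoly_reflect
  have hfin := M.finite_restrict (Set.empty_subset M.E)
  rw [h.sum_flats (by omega), restrict_ground_eq_self, h.charPoly_of_rank_one hn,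
    klPoly_contract_ground, Finset.sum_eq_single ∅, hr] at e
  · rw [if_pos (by simp), charPoly_of_ground (M ↾ ∅) rfl, contract_empty, one_mul, mul_one] at e
    obtain ⟨c, hc⟩ : ∃ c : ℤ, M.klPoly = C c := ⟨_, eq_C_of_natDegree_eq_zero (by omega)⟩
    rw [hc, reflect_C] at e
    have := congrArg (coeff · 0) e
    simp only [pow_one, coeff_add, coeff_sub, coeff_C_mul, coeff_X_zero, coeff_C_zero,
      coeff_one_zero, mul_zero] at this
    rw [hc, show c = 1 by omega, C_1]
  · intro A hA hne
    have hA := M.mem_subsetsFinset.1 (Finset.mem_filter.1 hA).1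
    have := (Set.ncard_pos (M.set_finite A hA)).2 (Set.nonempty_iff_ne_empty.2 hne)
    rw [if_neg (by omega)]
  · simp

end polynomials

/-- The inverse Kazhdan--Lusztig polynomial of a uniform matroid depends only on its parameters. -/
theorem exists_invKLPoly_uniform (r : ℕ) : ∃ q : ℕ → ℤ[X], ∀ {α : Type*} (M : Matroid α) [M.Finite]
    (n : ℕ), r ≤ n → M.IsUniform r n → M.invKLPoly = q n := by
  induction r using Nat.strong_induction_on with
  | _ r ih =>
  choose! q hq using ih
  rcases Nat.eq_zero_or_pos r with rfl | hr
  · refine ⟨fun n => if n = 0 then 1 else 0, fun M hM n _ h => ?_⟩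
    have hrank : M.rank = 0 := by rw [h.rank_eq, Nat.min_zero]
    by_cases hE : M.E = ∅
    · rw [isInvKLFamily_invKLPoly.eq_one M hM hrank hE]
      refine (if_pos ?_).symm
      rw [← h.ncard_ground, hE, Set.ncard_empty]
    · rw [isInvKLFamily_invKLPoly.eq_zero M hM hrank hE]
      refine (if_neg ?_).symm
      rw [← h.ncard_ground, Set.ncard_eq_zero M.ground_finite]
      exact hE
  -- The ground set contributes `(-1) ^ r` times the unknown polynomial. Every other flat is a set
  -- of `j < r` elements, with Boolean restriction, known by induction as `q j j`, and uniform
  -- contraction of rank `r - j` on `n - j` elements.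
  · refine ⟨fun n => -lowerHalf r ((-1) ^ r * ∑ j ∈ Finset.range (n + 1), n.choose j •
      if j < r then (-1) ^ j * q j j * (uniformCharPoly (r - j) (n - j)).reflect (r - j) else 0),
      fun M hM n hn h => ?_⟩
    classical
    have hrank : M.rank = r := by rw [h.rank_eq]; omega
    have hdeg := isInvKLFamily_invKLPoly.degree_lt M hM (by omega)
    have hrE : M.rk M.E = r := hrank
    have e := M.invKLPoly_reflect
    have hs : ∑ A ∈ M.subsetsFinset with A ⊆ M.E, (if A.ncard < r then (-1) ^ M.rk A *
        (M ↾ A).invKLPoly * (M ／ A).charPoly.reflect (M.rank - M.rk A) else 0) =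
        ∑ j ∈ Finset.range (n + 1), n.choose j •
          if j < r then (-1) ^ j * q j j * (uniformCharPoly (r - j) (n - j)).reflect (r - j)
            else 0 := by
      rw [← h.ncard_ground, ← M.sum_subsets_ncard subset_rfl fun j => if j < r then
        (-1) ^ j * q j j * (uniformCharPoly (r - j) (M.E.ncard - j)).reflect (r - j) else 0]
      refine Finset.sum_congr rfl fun A hA => ?_
      have hA := (Finset.mem_filter.1 hA).2
      split_ifs with hlt
      · have := M.finite_restrict hA
        rw [hrank, h.rk_eq A hA, min_eq_left hlt.le, (h.contract hA hlt.le).charPoly_eq,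
          hq _ hlt (M ↾ A) _ le_rfl (h.restrict hA hlt.le), h.ncard_ground]
      · rfl
    rw [h.sum_flats hn, hs, restrict_ground_eq_self, charPoly_contract_ground, hrank, hrE,
      Nat.sub_self, reflect_one, pow_zero, mul_one] at e
    refine eq_neg_lowerHalf (hrank ▸ hdeg) ?_
    have h1 : ((-1 : ℤ[X]) ^ r) * (-1) ^ r = 1 := by
      rw [← mul_pow]; simp
    -- Multiplying the recursion by `(-1) ^ r` removes the sign from both occurrences of `Q`, since
    -- the square of the sign is `1`.
    linear_combination (-1) ^ r * e + (M.invKLPoly - M.invKLPoly.reflect r) * h1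

/-! ### Relaxation expressed through rank functions -/

/-- `H` is a stressed hyperplane with more than `m` elements of the matroid `M` of rank `m + 1`,
and `N` is the relaxation of `M` at `H`, in terms of rank functions. -/
structure IsRelaxationPair (M N : Matroid α) (H : Set α) (m : ℕ) : Prop where
  ground_eq : N.E = M.E
  rank_eq : M.rank = m + 1
  isFlat : M.IsFlat H
  lt_ncard : m < H.ncard
  rk_of_subset : ∀ A ⊆ H, M.rk A = min A.ncard m
  rk_relaxation_of_subset : ∀ A ⊆ H, N.rk A = min A.ncard (m + 1)
  rk_relaxation_of_not_subset : ∀ A ⊆ M.E, ¬ A ⊆ H → N.rk A = M.rk A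

lemma Indep.ncard_le_rk {M : Matroid α} [M.Finite] {I A : Set α} (hI : M.Indep I) (h : I ⊆ A) :
    I.ncard ≤ M.rk A := by
  rw [← (M.indep_iff_rk_eq_ncard hI.subset_ground).1 hI]
  exact M.rk_mono h

lemma exists_indep_ncard_eq_rk (M : Matroid α) [M.Finite] {A : Set α} (hA : A ⊆ M.E) :
    ∃ I ⊆ A, M.Indep I ∧ I.ncard = M.rk A := by
  obtain ⟨I, hI⟩ := M.exists_isBasis A
  refine ⟨I, hI.subset, hI.indep, ?_⟩
  have := hI.encard_eq_eRk
  rw [← coe_rk, ← (M.set_finite I hI.indep.subset_ground).cast_ncard_eq] at this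
  exact_mod_cast this

lemma IsStressedHyperplane.isRelaxationPair {M : Matroid α} [M.Finite] {H : Set α}
    (hH : M.IsStressedHyperplane H) (h : M.rank ≤ H.ncard) :
    IsRelaxationPair M (M.relaxation H hH) H (M.rank - 1) := by
  obtain ⟨m, hm⟩ : ∃ m, M.rank = m + 1 := ⟨M.rk H, hH.1.2.symm⟩
  have hrH : M.rk H = m := by have := hH.1.2; omega
  rw [hm, Nat.add_sub_cancel]
  set N := M.relaxation H hH with hN
  have hHE := hH.1.1.subset_ground
  have hHfin := M.set_finite H hHE
  have hNr : N.rank = m + 1 := by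
    obtain ⟨B, hB⟩ := M.exists_isBase
    have hB' : N.IsBase B := Or.inl hB
    rw [← hB'.ncard_eq_rank, hB.ncard_eq_rank, hm]
  have hrk : ∀ A ⊆ H, M.rk A = min A.ncard m := by
    have hind : ∀ A ⊆ H, A.ncard ≤ m → M.Indep A := by
      intro A hA hle
      -- `H` is large enough to extend `A` to a set of `m + 1` elements inside `H`. That set is a
      -- circuit, and `A` is a proper subset of it by cardinality.
      obtain ⟨S, hAS, hSH, hS⟩ := Set.exists_subsuperset_card_eq hA (n := m + 1) (by omega)
        (by omega)
      refine (hH.2 S hSH (hS.trans hm.symm)).ssubset_indep (hAS.ssubset_of_ne ?_)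
      rintro rfl
      omega
    intro A hA
    rcases le_or_gt A.ncard m with hle | hlt
    · rw [(M.indep_iff_rk_eq_ncard (hA.trans hHE)).1 (hind A hA hle), min_eq_left hle]
    · obtain ⟨B, hBA, hB⟩ := Set.exists_subset_card_eq hlt.le
      have h1 := (hind B (hBA.trans hA) hB.le).ncard_le_rk hBA
      have h2 := M.rk_mono hA
      omega
  refine ⟨rfl, hm, hH.1.1, by omega, hrk, ?_, ?_⟩
  · have hind : ∀ A ⊆ H, A.ncard ≤ m + 1 → N.Indep A := by
      intro A hA hle
      obtain ⟨S, hAS, hSH, hS⟩ := Set.exists_subsuperset_card_eq hA (n := m + 1) hle (by omega)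
      have hS : N.IsBase S := Or.inr ⟨hSH, hS.trans hm.symm⟩
      exact hS.indep.subset hAS
    intro A hA
    rcases le_or_gt A.ncard (m + 1) with hle | hlt
    · have hAN : A ⊆ N.E := hA.trans hHE
      rw [(N.indep_iff_rk_eq_ncard hAN).1 (hind A hA hle), min_eq_left hle]
    · obtain ⟨B, hBA, hB⟩ := Set.exists_subset_card_eq hlt.le
      have h1 := (hind B (hBA.trans hA) hB.le).ncard_le_rk hBA
      have h2 := N.rk_le_rank A
      omega
  · intro A hA hAH
    apply le_antisymm
    · have hAN : A ⊆ N.E := hA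
      obtain ⟨I, hIA, hI, hcard⟩ := N.exists_indep_ncard_eq_rk hAN
      obtain ⟨B, hB, hIB⟩ := hI.exists_isBase_superset
      have hB : M.IsBase B ∨ (B ⊆ H ∧ B.ncard = M.rank) := hB
      rw [← hcard]
      rcases hB with hB | ⟨hBH, hB⟩
      · exact (hB.indep.subset hIB).ncard_le_rk hIA
      -- Here `I` lies in `H`. If `|I|` exceeded the rank of `A` in `M`, then `I` would have `m + 1`
      -- elements, and `I`, `A` and `H` would all have rank `m`. Their closures would then agree,
      -- forcing `A ⊆ H`.
      · have h1 := Set.ncard_le_ncard hIB (hHfin.subset hBH)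
        have h2 := hrk I (hIB.trans hBH)
        have h3 := M.rk_mono hIA
        by_contra hlt
        have e1 := M.closure_eq_of_rk_le hIA (by omega)
        have e2 := M.closure_eq_of_rk_le (hIB.trans hBH) (by omega)
        rw [e1, hH.1.1.closure] at e2
        exact hAH (e2 ▸ M.subset_closure A hA)
    · obtain ⟨I, hIA, hI, hcard⟩ := M.exists_indep_ncard_eq_rk hA
      obtain ⟨B, hB, hIB⟩ := hI.exists_isBase_superset
      have hB : N.IsBase B := Or.inl hB
      rw [← hcard]
      exact (hB.indep.subset hIB).ncard_le_rk hIA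

/-! ### Flats, restrictions and contractions of a relaxation pair -/

namespace IsRelaxationPair

variable {M N : Matroid α} [M.Finite] [N.Finite] {H F : Set α} {m : ℕ}

lemma rk_hyperplane (h : IsRelaxationPair M N H m) : M.rk H = m := by
  rw [h.rk_of_subset H subset_rfl]
  have := h.lt_ncard
  omega

lemma not_ground_subset (h : IsRelaxationPair M N H m) : ¬ M.E ⊆ H := by
  intro hE
  have := M.rk_mono hE
  rw [h.rk_hyperplane] at this
  have : M.rk M.E = m + 1 := h.rank_eq
  omega

lemma rank_relaxation (h : IsRelaxationPair M N H m) : N.rank = m + 1 := by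
  rw [rank, h.ground_eq, h.rk_relaxation_of_not_subset _ subset_rfl h.not_ground_subset]
  exact h.rank_eq

lemma isFlat_iff_of_subset (h : IsRelaxationPair M N H m) (hF : F ⊆ H) :
    M.IsFlat F ↔ F.ncard < m ∨ F = H := by
  have hHE := h.isFlat.subset_ground
  have hfin := M.set_finite F (hF.trans hHE)
  constructor
  · intro hfl
    refine or_iff_not_imp_left.2 fun hlt => ?_
    rw [← hfl.closure, ← h.isFlat.closure]
    refine M.closure_eq_of_rk_le hF ?_
    rw [h.rk_hyperplane, h.rk_of_subset F hF]
    omega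
  · rintro (hlt | rfl)
    · refine isFlat_iff_rk_lt.2 ⟨hF.trans hHE, fun e he heF => ?_⟩
      by_cases heH : e ∈ H
      · rw [h.rk_of_subset F hF, h.rk_of_subset _ (Set.insert_subset heH hF),
          Set.ncard_insert_of_notMem heF hfin]
        omega
      -- If an element outside `H` did not raise the rank of `F`, it would lie in the closure of
      -- `F`, hence in the flat `H`.
      · by_contra hle
        have e1 := M.closure_eq_of_rk_le (Set.subset_insert e F) (not_lt.1 hle)
        have e2 : e ∈ M.closure (insert e F) := M.subset_closure _
          (Set.insert_subset he (hF.trans hHE)) (Set.mem_insert e F)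
        rw [← e1] at e2
        exact heH (h.isFlat.closure ▸ M.closure_subset_closure hF e2)
    · exact h.isFlat

lemma isFlat_relaxation_iff_of_subset (h : IsRelaxationPair M N H m) (hF : F ⊆ H) :
    N.IsFlat F ↔ F.ncard < m + 1 := by
  have hHE := h.isFlat.subset_ground
  have hfin := M.set_finite F (hF.trans hHE)
  constructor
  · intro hfl
    by_contra hle
    have := hfl.eq_ground_of_rank_le (by
      rw [h.rank_relaxation, h.rk_relaxation_of_subset F hF]
      omega)
    rw [h.ground_eq] at this
    exact h.not_ground_subset (this ▸ hF)
  · intro hlt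
    refine isFlat_iff_rk_lt.2 ⟨h.ground_eq ▸ hF.trans hHE, fun e he heF => ?_⟩
    rw [h.ground_eq] at he
    by_cases heH : e ∈ H
    · rw [h.rk_relaxation_of_subset F hF,
        h.rk_relaxation_of_subset _ (Set.insert_subset heH hF),
        Set.ncard_insert_of_notMem heF hfin]
      omega
    · rw [h.rk_relaxation_of_not_subset _ (Set.insert_subset he (hF.trans hHE))
        fun hs => heH (hs (Set.mem_insert e F))]
      have h1 : M.rk F = F.ncard := by rw [h.rk_of_subset F hF]; omega
      have h2 : N.rk F = F.ncard := by rw [h.rk_relaxation_of_subset F hF]; omega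
      by_contra hle
      have e1 := M.closure_eq_of_rk_le (Set.subset_insert e F) (by omega)
      have e2 : e ∈ M.closure (insert e F) := M.subset_closure _
        (Set.insert_subset he (hF.trans hHE)) (Set.mem_insert e F)
      rw [← e1] at e2
      exact heH (h.isFlat.closure ▸ M.closure_subset_closure hF e2)

/-- Being a flat is tested on the ranks of `F` and of its one-element extensions; none of these sets
lies in `H`, so both matroids give the same ranks. -/
lemma isFlat_relaxation_iff_of_not_subset (h : IsRelaxationPair M N H m) (hF : ¬ F ⊆ H) :
    N.IsFlat F ↔ M.IsFlat F := by
  rw [isFlat_iff_rk_lt, isFlat_iff_rk_lt, h.ground_eq]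
  refine and_congr_right fun hFE => forall₂_congr fun e he => ?_
  rw [h.rk_relaxation_of_not_subset F hFE hF, h.rk_relaxation_of_not_subset _
    (Set.insert_subset he hFE) fun hs => hF ((Set.subset_insert e F).trans hs)]

/-- `F` is independent in both matroids, so contracting it lowers the ranks of the sets `A ∪ F` by
`|F|` on both sides, and `A ∪ F ⊆ H` exactly when `A ⊆ H \ F`. This is the inductive step behind the
smaller corrections. -/
lemma contract (h : IsRelaxationPair M N H m) (hF : F ⊆ H) (hm : F.ncard < m) :
    IsRelaxationPair (M ／ F) (N ／ F) (H \ F) (m - F.ncard) := by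
  have hHE := h.isFlat.subset_ground
  have hFE := hF.trans hHE
  have hfin := M.set_finite F hFE
  have hrM : M.rk F = F.ncard := by rw [h.rk_of_subset F hF]; omega
  have hrN : N.rk F = F.ncard := by rw [h.rk_relaxation_of_subset F hF]; omega
  have hsub : ∀ A ⊆ H \ F, A ∪ F ⊆ H ∧ (A ∪ F).ncard = A.ncard + F.ncard := by
    intro A hA
    have hA := Set.subset_sdiff.1 hA
    exact ⟨Set.union_subset hA.1 hF,
      Set.ncard_union_eq hA.2 (M.set_finite A (hA.1.trans hHE)) hfin⟩
  refine ⟨?_, ?_, ?_, ?_, fun A hA => ?_, fun A hA => ?_, fun A hA hAH => ?_⟩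
  · rw [contract_ground, contract_ground, h.ground_eq]
  · have := M.rank_contract hFE
    rw [h.rank_eq] at this
    omega
  · rw [M.isFlat_contract_iff hFE, Set.sdiff_union_of_subset hF]
    exact ⟨h.isFlat, Set.disjoint_sdiff_left⟩
  · rw [Set.ncard_sdiff hF hfin]
    have := h.lt_ncard
    omega
  · have h1 := M.rk_contract F A
    rw [h.rk_of_subset _ (hsub A hA).1, (hsub A hA).2] at h1
    omega
  · have h1 := N.rk_contract F A
    rw [h.rk_relaxation_of_subset _ (hsub A hA).1, (hsub A hA).2] at h1
    omega
  · have hA := Set.subset_sdiff.1 hA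
    have h1 := M.rk_contract F A
    have h2 := N.rk_contract F A
    rw [h.rk_relaxation_of_not_subset _ (Set.union_subset hA.1 hFE) fun hs =>
      hAH (Set.subset_sdiff.2 ⟨Set.subset_union_left.trans hs, hA.2⟩)] at h2
    omega

/-- Ranks in the contraction are differences of ranks of sets containing `F`, and no such set lies
in `H`. -/
lemma contract_eq (h : IsRelaxationPair M N H m) (hF : F ⊆ M.E) (hFH : ¬ F ⊆ H) :
    N ／ F = M ／ F := by
  refine ext_rk _ (by rw [contract_ground, contract_ground, h.ground_eq]) fun A hA => ?_
  have hA : A ⊆ M.E := by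
    rw [contract_ground, h.ground_eq] at hA
    exact hA.trans Set.sdiff_subset
  have h1 := M.rk_contract F A
  have h2 := N.rk_contract F A
  rw [h.rk_relaxation_of_not_subset _ (Set.union_subset hA hF) fun hs =>
    hFH (Set.subset_union_right.trans hs), h.rk_relaxation_of_not_subset F hF hFH] at h2
  omega

lemma restrict_eq (h : IsRelaxationPair M N H m) (hF : M.IsFlat F) (hFH : ¬ F ⊆ H)
    (hne : F ≠ M.E) : N ↾ F = M ↾ F := by
  have hFE := hF.subset_ground
  have := M.finite_restrict hFE
  have := N.finite_restrict (h.ground_eq ▸ hFE)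
  refine ext_rk _ rfl fun A hA => ?_
  have hA : A ⊆ F := hA
  rw [rk_restrict M hA, rk_restrict N hA]
  by_cases hAH : A ⊆ H
  · rw [h.rk_of_subset A hAH, h.rk_relaxation_of_subset A hAH]
    by_contra hcon
    have e1 := M.closure_eq_of_rk_le hAH (by rw [h.rk_hyperplane, h.rk_of_subset A hAH]; omega)
    rw [h.isFlat.closure] at e1
    have hHF : H ⊆ F := by
      rw [← e1, ← hF.closure]
      exact M.closure_subset_closure hA
    obtain ⟨e, heF, heH⟩ := Set.not_subset.1 hFH
    have h1 := h.isFlat.rk_insert (hFE heF) heH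
    have h2 := M.rk_mono (Set.insert_subset heF hHF)
    rw [h.rk_hyperplane] at h1
    exact hne (hF.eq_ground_of_rank_le (by rw [h.rank_eq]; omega))
  · exact h.rk_relaxation_of_not_subset A (hA.trans hFE) hAH

lemma isUniform_restrict (h : IsRelaxationPair M N H m) (hF : F ⊆ H) (hm : F.ncard ≤ m) :
    (M ↾ F).IsUniform F.ncard F.ncard := by
  refine ⟨rfl, fun A hA => ?_⟩
  have hA : A ⊆ F := hA
  have := Set.ncard_le_ncard hA (M.set_finite F (hF.trans h.isFlat.subset_ground))
  rw [rk_restrict M hA, h.rk_of_subset A (hA.trans hF)]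
  omega

lemma isUniform_restrict_relaxation (h : IsRelaxationPair M N H m) (hF : F ⊆ H)
    (hm : F.ncard ≤ m) : (N ↾ F).IsUniform F.ncard F.ncard := by
  refine ⟨rfl, fun A hA => ?_⟩
  have hA : A ⊆ F := hA
  have := Set.ncard_le_ncard hA (M.set_finite F (hF.trans h.isFlat.subset_ground))
  rw [rk_restrict N hA, h.rk_relaxation_of_subset A (hA.trans hF)]
  omega

lemma isUniform_restrict_hyperplane (h : IsRelaxationPair M N H m) :
    (M ↾ H).IsUniform m H.ncard := by
  refine ⟨rfl, fun A hA => ?_⟩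
  have hA : A ⊆ H := hA
  rw [rk_restrict M hA, h.rk_of_subset A hA]

/-- The contraction has rank one, and it has no loops because `H` is a flat. The size `n` is left
unspecified: in rank one neither the characteristic polynomial nor `P` depends on it. -/
lemma isUniform_contract_hyperplane (h : IsRelaxationPair M N H m) :
    ∃ n ≠ 0, (M ／ H).IsUniform 1 n := by
  refine ⟨_, ?_, rfl, fun A hA => ?_⟩
  · rw [contract_ground, Ne, Set.ncard_eq_zero (M.ground_finite.sdiff), Set.sdiff_eq_empty]
    exact h.not_ground_subset
  · have hA := Set.subset_sdiff.1 hA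
    have h1 := M.rk_contract H A
    rw [h.rk_hyperplane] at h1
    rcases A.eq_empty_or_nonempty with rfl | ⟨e, he⟩
    · simp [rk_empty]
    · have h2 := h.isFlat.rk_insert (hA.1 he) (Set.disjoint_left.1 hA.2 he)
      have h3 := M.rk_mono (Set.insert_subset (Set.mem_union_left H he) Set.subset_union_right)
      have h4 := M.rk_le_rank (A ∪ H)
      have h5 := (Set.ncard_pos (M.set_finite A hA.1)).2 ⟨e, he⟩
      rw [h.rk_hyperplane] at h2
      rw [h.rank_eq] at h4
      omega

lemma isUniform_contract_relaxation (h : IsRelaxationPair M N H m) (hF : F ⊆ H)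
    (hm : F.ncard = m) : ∃ n ≠ 0, (N ／ F).IsUniform 1 n := by
  have hfl : N.IsFlat F := (h.isFlat_relaxation_iff_of_subset hF).2 (by omega)
  have hr : N.rk F = m := by rw [h.rk_relaxation_of_subset F hF]; omega
  refine ⟨_, ?_, rfl, fun A hA => ?_⟩
  · rw [contract_ground, Ne, Set.ncard_eq_zero (N.ground_finite.sdiff), Set.sdiff_eq_empty,
      h.ground_eq]
    exact fun hs => h.not_ground_subset (hs.trans hF)
  · have hA := Set.subset_sdiff.1 hA
    have h1 := N.rk_contract F A
    rw [hr] at h1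
    rcases A.eq_empty_or_nonempty with rfl | ⟨e, he⟩
    · simp [rk_empty]
    · have h2 := hfl.rk_insert (hA.1 he) (Set.disjoint_left.1 hA.2 he)
      have h3 := N.rk_mono (Set.insert_subset (Set.mem_union_left F he) Set.subset_union_right)
      have h4 := N.rk_le_rank (A ∪ F)
      have h5 := (Set.ncard_pos (N.set_finite A hA.1)).2 ⟨e, he⟩
      rw [h.rank_relaxation] at h4
      omega

end IsRelaxationPair

/-! ### Subtracting sums over flats -/

/-- The difference of the characteristic polynomials of the relaxation and of a matroid of rank
`m + 1`, for a stressed hyperplane with `h` elements. -/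
noncomputable def charPolyCorrection (m h : ℕ) : ℤ[X] :=
  -- The bracket vanishes for `j ≤ m` and equals `1 - X` for every larger `j`.
  ∑ j ∈ Finset.range (h + 1),
    h.choose j • ((-1) ^ j * (X ^ (m + 1 - min j (m + 1)) - X ^ (m + 1 - min j m)))

namespace IsRelaxationPair

variable {M N : Matroid α} [hM : M.Finite] [hN : N.Finite] {H : Set α} {m : ℕ}

lemma charPoly_eq (h : IsRelaxationPair M N H m) :
    N.charPoly = M.charPoly + charPolyCorrection m H.ncard := by
  classical
  have hs : N.subsetsFinset = M.subsetsFinset := by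
    ext A
    simp [h.ground_eq]
  rw [charPolyCorrection, ← M.sum_subsets_ncard h.isFlat.subset_ground fun j =>
    (-1) ^ j * (X ^ (m + 1 - min j (m + 1)) - X ^ (m + 1 - min j m)), ← sub_eq_iff_eq_add',
    charPoly_eq_sum, charPoly_eq_sum, hs, ← Finset.sum_sub_distrib, Finset.sum_filter,
    h.rank_eq, h.rank_relaxation]
  refine Finset.sum_congr rfl fun A hA => ?_
  split_ifs with hAH
  · rw [h.rk_of_subset A hAH, h.rk_relaxation_of_subset A hAH, mul_sub]
  · rw [h.rk_relaxation_of_not_subset A (M.mem_subsetsFinset.1 hA) hAH, sub_self]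

open Classical in
lemma sum_flats (h : IsRelaxationPair M N H m) (f : Set α → ℤ[X]) :
    ∑ F ∈ M.flatsFinset, f F = ∑ F ∈ M.flatsFinset with ¬ F ⊆ H, f F +
      (∑ A ∈ M.subsetsFinset with A ⊆ H, (if A.ncard < m then f A else 0) + f H) := by
  have hH : H ∉ (M.subsetsFinset.filter (· ⊆ H)).filter fun A => A.ncard < m := by
    simp [h.lt_ncard.le]
  rw [← Finset.sum_filter_add_sum_filter_not M.flatsFinset (fun F => ¬ F ⊆ H),
    ← Finset.sum_filter (fun A : Set α => A.ncard < m), add_comm (Finset.sum _ _) (f H),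
    ← Finset.sum_insert hH]
  congr 1
  refine Finset.sum_congr ?_ fun _ _ => rfl
  ext F
  simp only [Finset.mem_filter, mem_flatsFinset, mem_subsetsFinset, Finset.mem_insert, not_not]
  constructor
  · rintro ⟨hF, hFH⟩
    have := (h.isFlat_iff_of_subset hFH).1 hF
    have := hF.subset_ground
    tauto
  · rintro (rfl | ⟨⟨_, hFH⟩, hlt⟩)
    · exact ⟨h.isFlat, subset_rfl⟩
    · exact ⟨(h.isFlat_iff_of_subset hFH).2 (Or.inl hlt), hFH⟩

open Classical in
lemma sum_flats_relaxation (h : IsRelaxationPair M N H m) (f : Set α → ℤ[X]) :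
    ∑ F ∈ N.flatsFinset, f F = ∑ F ∈ M.flatsFinset with ¬ F ⊆ H, f F +
      ∑ A ∈ M.subsetsFinset with A ⊆ H, (if A.ncard < m + 1 then f A else 0) := by
  rw [← Finset.sum_filter_add_sum_filter_not N.flatsFinset (fun F => ¬ F ⊆ H),
    ← Finset.sum_filter (fun A : Set α => A.ncard < m + 1)]
  congr 1
  · refine Finset.sum_congr ?_ fun _ _ => rfl
    ext F
    simp only [Finset.mem_filter, mem_flatsFinset]
    exact and_congr_left fun hF => h.isFlat_relaxation_iff_of_not_subset hF
  · refine Finset.sum_congr ?_ fun _ _ => rfl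
    ext F
    simp only [Finset.mem_filter, mem_flatsFinset, mem_subsetsFinset, not_not]
    constructor
    · rintro ⟨hF, hFH⟩
      exact ⟨⟨h.ground_eq ▸ hF.subset_ground, hFH⟩, (h.isFlat_relaxation_iff_of_subset hFH).1 hF⟩
    · rintro ⟨⟨_, hFH⟩, hlt⟩
      exact ⟨(h.isFlat_relaxation_iff_of_subset hFH).2 hlt, hFH⟩

/-- The common bookkeeping for `P`, `Q` and `Z`. The ground set is kept apart because the
restrictions to it are `N` and `M` themselves. The value `b` belongs to the `m`-element subsets of
`H`, which are flats of `N` only, and `g H` to the flat `H` that is lost. -/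
lemma sum_flats_sub (h : IsRelaxationPair M N H m) (f g : Set α → ℤ[X]) (a : ℕ → ℤ[X])
    (b : ℤ[X]) (hfg : ∀ F, M.IsFlat F → ¬ F ⊆ H → F ≠ M.E → f F = g F)
    (ha : ∀ A ⊆ H, A.ncard < m → f A - g A = a A.ncard)
    (hb : ∀ A ⊆ H, A.ncard = m → f A = b) :
    ∑ F ∈ N.flatsFinset, f F - ∑ F ∈ M.flatsFinset, g F = (f M.E - g M.E) +
      ∑ j ∈ Finset.range (H.ncard + 1), H.ncard.choose j •
        (if j < m then a j else if j = m then b else 0) - g H := by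
  classical
  have h1 : ∑ F ∈ M.flatsFinset with ¬ F ⊆ H, f F - ∑ F ∈ M.flatsFinset with ¬ F ⊆ H, g F =
      f M.E - g M.E := by
    rw [← Finset.sum_sub_distrib, Finset.sum_eq_single M.E]
    · intro F hF hne
      obtain ⟨hF, hFH⟩ := Finset.mem_filter.1 hF
      rw [hfg F (M.mem_flatsFinset.1 hF) hFH hne, sub_self]
    · intro hE
      exact absurd (Finset.mem_filter.2
        ⟨M.mem_flatsFinset.2 M.ground_isFlat, h.not_ground_subset⟩) hE
  have h2 : ∑ A ∈ M.subsetsFinset with A ⊆ H, (if A.ncard < m + 1 then f A else 0) -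
      ∑ A ∈ M.subsetsFinset with A ⊆ H, (if A.ncard < m then g A else 0) =
      ∑ j ∈ Finset.range (H.ncard + 1), H.ncard.choose j •
        (if j < m then a j else if j = m then b else 0) := by
    rw [← M.sum_subsets_ncard h.isFlat.subset_ground fun j =>
      if j < m then a j else if j = m then b else 0, ← Finset.sum_sub_distrib]
    refine Finset.sum_congr rfl fun A hA => ?_
    have hAH := (Finset.mem_filter.1 hA).2
    rcases lt_trichotomy A.ncard m with hlt | heq | hgt
    · rw [if_pos (by omega), if_pos hlt, if_pos hlt, ha A hAH hlt]
    · rw [if_pos (by omega), if_neg (by omega), if_neg (by omega), if_pos heq, hb A hAH heq,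
        sub_zero]
    · rw [if_neg (by omega), if_neg (by omega), if_neg (by omega), if_neg (by omega), sub_zero]
  rw [h.sum_flats_relaxation, h.sum_flats]
  linear_combination h1 + h2

lemma finite_restrict_left (h : IsRelaxationPair M N H m) {F : Set α} (hF : F ⊆ H) :
    (M ↾ F).Finite :=
  M.finite_restrict (hF.trans h.isFlat.subset_ground)

lemma finite_restrict_right (h : IsRelaxationPair M N H m) {F : Set α} (hF : F ⊆ H) :
    (N ↾ F).Finite :=
  N.finite_restrict (h.ground_eq ▸ hF.trans h.isFlat.subset_ground)

lemma klPoly_contract_hyperplane (h : IsRelaxationPair M N H m) : (M ／ H).klPoly = 1 := by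
  obtain ⟨n, hn, hu⟩ := h.isUniform_contract_hyperplane
  exact hu.klPoly_of_rank_one hn

lemma klPoly_contract_relaxation (h : IsRelaxationPair M N H m) {F : Set α} (hF : F ⊆ H)
    (hm : F.ncard = m) : (N ／ F).klPoly = 1 := by
  obtain ⟨n, hn, hu⟩ := h.isUniform_contract_relaxation hF hm
  exact hu.klPoly_of_rank_one hn

lemma ncard_sdiff (h : IsRelaxationPair M N H m) {F : Set α} (hF : F ⊆ H) :
    (H \ F).ncard = H.ncard - F.ncard :=
  Set.ncard_sdiff hF (M.set_finite F (hF.trans h.isFlat.subset_ground))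

lemma uniformCharPoly_zero : uniformCharPoly 0 0 = 1 := by
  simp [uniformCharPoly]

/-- The function `p` stands for the corrections of the contracted pairs. When `m > 0` the hypothesis
also covers `A = ∅`, where `p m H.ncard` is the unknown difference itself. -/
lemma klPoly_reflect_sub (h : IsRelaxationPair M N H m) (p : ℕ → ℕ → ℤ[X])
    (hp : ∀ A ⊆ H, A.ncard < m →
      (N ／ A).klPoly - (M ／ A).klPoly = p (m - A.ncard) (H.ncard - A.ncard)) :
    (N.klPoly - M.klPoly).reflect (m + 1) = charPolyCorrection m H.ncard +
      ∑ j ∈ Finset.range (H.ncard + 1), H.ncard.choose j •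
        (if j < m then uniformCharPoly j j * p (m - j) (H.ncard - j)
          else if j = m then uniformCharPoly m m else 0) - uniformCharPoly m H.ncard := by
  have hNE : (N ／ M.E).klPoly = 1 := h.ground_eq ▸ N.klPoly_contract_ground
  have hE : N ↾ M.E = N := by rw [← h.ground_eq, restrict_ground_eq_self]
  rw [reflect_sub, ← h.rank_relaxation, klPoly_reflect, h.rank_relaxation, ← h.rank_eq,
    klPoly_reflect, h.sum_flats_sub (fun F => (N ↾ F).charPoly * (N ／ F).klPoly)
      (fun F => (M ↾ F).charPoly * (M ／ F).klPoly)
      (fun j => uniformCharPoly j j * p (m - j) (H.ncard - j)) (uniformCharPoly m m)]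
  · have := h.finite_restrict_left subset_rfl
    rw [hNE, klPoly_contract_ground, hE, restrict_ground_eq_self, h.klPoly_contract_hyperplane,
      h.isUniform_restrict_hyperplane.charPoly_eq, h.charPoly_eq]
    ring
  · intro F hF hFH hne
    rw [h.restrict_eq hF hFH hne, h.contract_eq hF.subset_ground hFH]
  · intro A hA hlt
    have := h.finite_restrict_left hA
    have := h.finite_restrict_right hA
    rw [(h.isUniform_restrict hA hlt.le).charPoly_eq,
      (h.isUniform_restrict_relaxation hA hlt.le).charPoly_eq, ← mul_sub, hp A hA hlt]
  · intro A hA heq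
    have := h.finite_restrict_right hA
    rw [(h.isUniform_restrict_relaxation hA heq.le).charPoly_eq,
      h.klPoly_contract_relaxation hA heq, heq, mul_one]

lemma natDegree_klPoly_sub (h : IsRelaxationPair M N H m) :
    2 * (N.klPoly - M.klPoly).natDegree < m + 1 := by
  have hr := h.rank_eq
  have hr' := h.rank_relaxation
  refine natDegree_sub_lt ?_ ?_
  · rw [← hr']
    exact isKLFamily_klPoly.degree_lt N hN (by omega)
  · rw [← hr]
    exact isKLFamily_klPoly.degree_lt M hM (by omega)

lemma natDegree_invKLPoly_sub (h : IsRelaxationPair M N H m) :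
    2 * (N.invKLPoly - M.invKLPoly).natDegree < m + 1 := by
  have hr := h.rank_eq
  have hr' := h.rank_relaxation
  refine natDegree_sub_lt ?_ ?_
  · rw [← hr']
    exact isInvKLFamily_invKLPoly.degree_lt N hN (by omega)
  · rw [← hr]
    exact isInvKLFamily_invKLPoly.degree_lt M hM (by omega)

end IsRelaxationPair

/-! ### The correction polynomials and the theorem -/

theorem exists_klPoly_relaxation (m : ℕ) : ∃ p : ℕ → ℤ[X], ∀ {α : Type*} (M N : Matroid α)
    [M.Finite] [N.Finite] (H : Set α), IsRelaxationPair M N H m →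
      N.klPoly - M.klPoly = p H.ncard := by
  induction m using Nat.strong_induction_on with
  | _ m ih =>
  choose! p hp using ih
  rcases Nat.eq_zero_or_pos m with rfl | hm
  -- For `m = 0` no set has fewer than `m` elements, so no unknown remains on the right: the
  -- recursion gives the reflected difference outright, and reflecting again recovers it.
  · refine ⟨fun n => (charPolyCorrection 0 n + ∑ j ∈ Finset.range (n + 1), n.choose j •
      (if j < 0 then uniformCharPoly j j * p (0 - j) (n - j)
        else if j = 0 then uniformCharPoly 0 0 else 0) - uniformCharPoly 0 n).reflect 1,
      fun M N _ _ H h => ?_⟩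
    have := h.klPoly_reflect_sub p fun _ _ h => absurd h (Nat.not_lt_zero _)
    beta_reduce
    rw [← this, zero_add, reflect_reflect]
  -- The sum is shifted by one because the term of the empty set is the unknown difference, which
  -- has to stand apart for `eq_neg_lowerHalf`.
  · refine ⟨fun n => -lowerHalf (m + 1) (charPolyCorrection m n +
      ∑ j ∈ Finset.range n, n.choose (j + 1) •
        (if j + 1 < m then uniformCharPoly (j + 1) (j + 1) * p (m - (j + 1)) (n - (j + 1))
          else if j + 1 = m then uniformCharPoly m m else 0) - uniformCharPoly m n),
      fun M N _ _ H h => ?_⟩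
    refine eq_neg_lowerHalf h.natDegree_klPoly_sub ?_
    -- The induction supplies `p r` only for `r < m`. At `r = m`, reached only by the empty set, the
    -- difference itself is inserted.
    have := h.klPoly_reflect_sub (fun r n => if r = m then N.klPoly - M.klPoly else p r n) ?_
    · rw [this, Finset.sum_range_succ']
      have hsum : ∀ j ∈ Finset.range H.ncard, H.ncard.choose (j + 1) •
          (if j + 1 < m then uniformCharPoly (j + 1) (j + 1) *
            (if m - (j + 1) = m then N.klPoly - M.klPoly else
              p (m - (j + 1)) (H.ncard - (j + 1)))
            else if j + 1 = m then uniformCharPoly m m else 0) = H.ncard.choose (j + 1) •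
          (if j + 1 < m then uniformCharPoly (j + 1) (j + 1) *
            p (m - (j + 1)) (H.ncard - (j + 1))
            else if j + 1 = m then uniformCharPoly m m else 0) := by
        intro j _
        rw [if_neg (show m - (j + 1) ≠ m by omega)]
      rw [Finset.sum_congr rfl hsum, if_pos hm, Nat.sub_zero, if_pos rfl,
        IsRelaxationPair.uniformCharPoly_zero, Nat.choose_zero_right, one_smul, one_mul]
      ring
    · intro A hA hlt
      rcases Nat.eq_zero_or_pos A.ncard with h0 | hpos
      · have hA0 := (Set.ncard_eq_zero
          (M.set_finite A (hA.trans h.isFlat.subset_ground))).1 h0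
        rw [if_pos (by omega), hA0, contract_empty, contract_empty]
      · rw [if_neg (by omega), hp _ (by omega) _ _ _ (h.contract hA hlt), h.ncard_sdiff hA]

theorem exists_invKLPoly_relaxation (m : ℕ) : ∃ q : ℕ → ℤ[X], ∀ {α : Type*} (M N : Matroid α)
    [M.Finite] [N.Finite] (H : Set α), IsRelaxationPair M N H m →
      N.invKLPoly - M.invKLPoly = q H.ncard := by
  choose q hq using exists_invKLPoly_uniform
  -- For `j < m` both restrictions are Boolean with the same `Q`, and the contractions form a pair
  -- whose characteristic polynomials differ by `charPolyCorrection`. The `m`-element sets and `H`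
  -- have rank-one contractions, whence the factor `X - 1`. The ground set gives the unknown
  -- difference.
  refine ⟨fun n => -lowerHalf (m + 1) ((-1) ^ (m + 1) * (∑ j ∈ Finset.range (n + 1), n.choose j •
      (if j < m then
        (-1) ^ j * q j j * (charPolyCorrection (m - j) (n - j)).reflect (m + 1 - j)
        else if j = m then (-1) ^ m * q m m * (X - 1 : ℤ[X]).reflect 1 else 0) -
      (-1) ^ m * q m n * (X - 1 : ℤ[X]).reflect 1)), fun M N _ _ H h => ?_⟩
  refine eq_neg_lowerHalf h.natDegree_invKLPoly_sub ?_
  have hEE : (N ／ M.E).charPoly = 1 := h.ground_eq ▸ N.charPoly_contract_ground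
  have hE : N ↾ M.E = N := by rw [← h.ground_eq, restrict_ground_eq_self]
  have hrE : M.rk M.E = m + 1 := h.rank_eq
  have hrE' : N.rk M.E = m + 1 := h.ground_eq ▸ h.rank_relaxation
  have e := h.sum_flats_sub
    (fun F => (-1) ^ N.rk F * (N ↾ F).invKLPoly * (N ／ F).charPoly.reflect (N.rank - N.rk F))
    (fun F => (-1) ^ M.rk F * (M ↾ F).invKLPoly * (M ／ F).charPoly.reflect (M.rank - M.rk F))
    (fun j => (-1) ^ j * q j j *
      (charPolyCorrection (m - j) (H.ncard - j)).reflect (m + 1 - j))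
    ((-1) ^ m * q m m * (X - 1 : ℤ[X]).reflect 1) ?_ ?_ ?_
  · have := h.finite_restrict_left subset_rfl
    obtain ⟨n, hn, hu⟩ := h.isUniform_contract_hyperplane
    rw [← invKLPoly_reflect, ← invKLPoly_reflect, hE, restrict_ground_eq_self, hEE,
      charPoly_contract_ground, hrE, hrE', h.rank_eq, h.rank_relaxation, h.rk_hyperplane,
      Nat.sub_self, Nat.add_sub_cancel_left, hu.charPoly_of_rank_one hn, reflect_one, pow_zero,
      hq m (M ↾ H) _ h.lt_ncard.le h.isUniform_restrict_hyperplane] at e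
    have h1 : ((-1 : ℤ[X]) ^ (m + 1)) * (-1) ^ (m + 1) = 1 := by
      rw [← mul_pow]; simp
    rw [reflect_sub]
    linear_combination (-1) ^ (m + 1) * e + (N.invKLPoly - M.invKLPoly -
      (N.invKLPoly.reflect (m + 1) - M.invKLPoly.reflect (m + 1))) * h1
  · intro F hF hFH hne
    rw [h.restrict_eq hF hFH hne, h.contract_eq hF.subset_ground hFH,
      h.rk_relaxation_of_not_subset F hF.subset_ground hFH, h.rank_eq, h.rank_relaxation]
  · intro A hA hlt
    have := h.finite_restrict_left hA
    have := h.finite_restrict_right hA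
    have hrM : M.rk A = A.ncard := by rw [h.rk_of_subset A hA]; omega
    have hrN : N.rk A = A.ncard := by rw [h.rk_relaxation_of_subset A hA]; omega
    rw [hrM, hrN, h.rank_eq, h.rank_relaxation,
      hq _ (M ↾ A) _ le_rfl (h.isUniform_restrict hA hlt.le),
      hq _ (N ↾ A) _ le_rfl (h.isUniform_restrict_relaxation hA hlt.le),
      (h.contract hA hlt).charPoly_eq, reflect_add, h.ncard_sdiff hA]
    ring
  · intro A hA heq
    have := h.finite_restrict_right hA
    have hrN : N.rk A = m := by rw [h.rk_relaxation_of_subset A hA]; omega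
    obtain ⟨n, hn, hu⟩ := h.isUniform_contract_relaxation hA heq
    rw [hq _ (N ↾ A) _ le_rfl (h.isUniform_restrict_relaxation hA heq.le), hrN,
      h.rank_relaxation, Nat.add_sub_cancel_left, hu.charPoly_of_rank_one hn, heq]

theorem exists_zPoly_relaxation (m : ℕ) : ∃ z : ℕ → ℤ[X], ∀ {α : Type*} (M N : Matroid α)
    [M.Finite] [N.Finite] (H : Set α), IsRelaxationPair M N H m →
      N.zPoly - M.zPoly = z H.ncard := by
  choose p hp using exists_klPoly_relaxation
  -- The ground set cancels, contributing `X ^ (m + 1)` on both sides. The `m`-element subsets of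
  -- `H` each add `X ^ m`, and the lost flat `H` removes one `X ^ m`.
  refine ⟨fun n => ∑ j ∈ Finset.range (n + 1), n.choose j •
      (if j < m then X ^ j * p (m - j) (n - j) else if j = m then X ^ m else 0) - X ^ m,
      fun M N _ _ H h => ?_⟩
  have hEE : (N ／ M.E).klPoly = 1 := h.ground_eq ▸ N.klPoly_contract_ground
  have hrE : M.rk M.E = m + 1 := h.rank_eq
  have hrE' : N.rk M.E = m + 1 := h.ground_eq ▸ h.rank_relaxation
  rw [zPoly_eq_sum, zPoly_eq_sum, h.sum_flats_sub _ _
    (fun j => X ^ j * p (m - j) (H.ncard - j)) (X ^ m)]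
  · rw [hEE, klPoly_contract_ground, hrE, hrE', h.klPoly_contract_hyperplane, h.rk_hyperplane]
    ring
  · intro F hF hFH hne
    rw [h.contract_eq hF.subset_ground hFH, h.rk_relaxation_of_not_subset F hF.subset_ground hFH]
  · intro A hA hlt
    have hrM : M.rk A = A.ncard := by rw [h.rk_of_subset A hA]; omega
    have hrN : N.rk A = A.ncard := by rw [h.rk_relaxation_of_subset A hA]; omega
    rw [hrM, hrN, ← mul_sub, hp _ _ _ _ (h.contract hA hlt), h.ncard_sdiff hA]
  · intro A hA heq
    have hrN : N.rk A = m := by rw [h.rk_relaxation_of_subset A hA]; omega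
    rw [hrN, h.klPoly_contract_relaxation hA heq, mul_one]

lemma relaxation_eq_self {α : Type*} (M : Matroid α) [M.Finite] (H : Set α)
    (hH : M.IsStressedHyperplane H) (h : H.ncard < M.rank) : M.relaxation H hH = M := by
  refine ext_isBase rfl fun B _ => ?_
  rw [relaxation_isBase_iff, or_iff_left]
  rintro ⟨hB, hcard⟩
  have := Set.ncard_le_ncard hB (M.set_finite H hH.1.1.subset_ground)
  omega

end Matroid

theorem theorem1p2 (k h : ℕ) (hk : 1 ≤ k) (hh : 1 ≤ h) :
    ∃ p q z : ℤ[X],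
      ∀ {α : Type*} (M : Matroid α) [M.Finite] (H : Set α) (hH : M.IsStressedHyperplane H),
        M.rank = k → H.ncard = h →
          (M.relaxation H hH).klPoly = M.klPoly + p ∧
          (M.relaxation H hH).invKLPoly = M.invKLPoly + q ∧
          (M.relaxation H hH).zPoly = M.zPoly + z := by
  rcases lt_or_ge h k with hlt | hle
  -- With `h < k` the hyperplane has no `k`-element subsets, so no bases are added.
  · refine ⟨0, 0, 0, fun M _ H hH hr hc => ?_⟩
    rw [Matroid.relaxation_eq_self M H hH (by omega)]
    simp
  · obtain ⟨p, hp⟩ := Matroid.exists_klPoly_relaxation (k - 1)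
    obtain ⟨q, hq⟩ := Matroid.exists_invKLPoly_relaxation (k - 1)
    obtain ⟨z, hz⟩ := Matroid.exists_zPoly_relaxation (k - 1)
    refine ⟨p h, q h, z h, fun M _ H hH hr hc => ?_⟩
    subst hr hc
    have hpair := hH.isRelaxationPair hle
    exact ⟨sub_eq_iff_eq_add'.1 (hp _ _ _ hpair), sub_eq_iff_eq_add'.1 (hq _ _ _ hpair),
      sub_eq_iff_eq_add'.1 (hz _ _ _ hpair)⟩
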